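/- **Theorem 5.2.** Let $\delta>0$ and let $\rho_0,u_0\in C^1(\mathbb R)$ satisfy $\rho_0>0$, $u_0'$ bounded, and $(1+x^2)^{(2+\delta)/2}\rho_0(x)$ bounded. Put $M_0:=\int_{\mathbb R}\rho_0\,dx$ (so $0<M_0<\infty$) and consider, with $W(x)=-|x|+\tfrac{|x|^2}{2}$, $$\rho_t+(\rho u)_x=0,\qquad u_t+uu_x+u=-\partial W\star\rho,\qquad \rho(x,0)=\rho_0(x),\quad u(x,0)=u_0(x).$$ *Solutions.* A solution on $[0,T)$ is a pair with $\rho\in C^0(\mathbb R\times[0,T))$ and $u\in C^1(\mathbb R\times[0,T))$ that takes the initial data, satisfies the second equation pointwise for $0<t<T$, satisfies the first equation in integral form, $$\int_a^b\rho(x,t)\,dx=\int_a^b\rho_0(x)\,dx+\int_0^t\bigl[(\rho u)(a,s)-(\rho u)(b,s)\bigr]ds\qquad(a,b\in\mathbb R,\ 0\le t<T),$$ and satisfies the far-field conditions: for each $t\in[0,T)$ and $i=1,2$, $\rho(x,t)|u(x,t)|^i\to0$ as $|x|\to\infty$; and for each $T'\in[0,T)$ there is $C$ with $|x|^{2+\delta}|\rho(x,t)|\le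 C$ for all $x\in\mathbb R$, $t\in[0,T']$. A classical solution on $[0,T)$ is a pair $\rho,u\in C^1(\mathbb R\times[0,T))$ that takes the initial data, satisfies both equations pointwise for $0<t<T$, and satisfies the same far-field conditions. *Breakdown.* There is finite-time breakdown, for either notion of solution, if for some $0<T<\infty$ a solution exists on $[0,T)$ and none exists on $[0,T')$ for any $T'>T$. *Conclusion.* There is finite-time breakdown of solutions if and only if there exists $x\in\mathbb R$ such that the following condition holds. If moreover $u_0\in C^2(\mathbb R)$, there is finite-time breakdown of classical solutions if and only if there exists $x\in\mathbb R$ such that the same condition holds. 1. (Subcritical mass, $M_0<1/4$) $$\max\{u_0'(x),\ u_0'(x)+\lambda_2(\tfrac{M_0}{2}-\rho_0(x))\}<0$$ and $$\left|\frac{\tfrac{M_0}{2}\lambda_2u_0'(x)+M_0-2\rho_0(x)}{2\rho_0(x)}\right|^{\lambda_1}\le\left|\frac{\tfrac{M_0}{2}\lambda_1u_0'(x)+M_0-2\rho_0(x)}{2\rho_0(x)}\right|^{\lambda_2},$$ where $\lambda_1=\frac{1-\sqrt{1-4M_0}}{M_0}$ and $\lambda_2=\frac{1+\sqrt{1-4M_0}}{M_0}$.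 2. (Critical mass, $M_0=1/4$) $$\max\{u_0'(x),\ M_0u_0'(x)+\tfrac{M_0}{2}-\rho_0(x)\}<0$$ and $$\ln\left(-\frac{M_0u_0'(x)+\tfrac{M_0}{2}-\rho_0(x)}{\rho_0(x)}\right)\ge\frac{M_0u_0'(x)}{M_0u_0'(x)+\tfrac{M_0}{2}-\rho_0(x)}.$$ 3. (Supercritical mass, $M_0>1/4$) $$\left(u_0'(x)+\frac{\tfrac{M_0}{2}-\rho_0(x)}{M_0}\right)^2\ge\left(M_0-\tfrac14\right)\left[\frac{4\rho_0(x)^2}{M_0^2}\left(\frac{M_0e^{t^*}}{M_0-\frac14}-1\right)+\frac{4\rho_0(x)-M_0}{M_0}\right],$$ where $$t^*=\frac1{\sqrt{M_0-\frac14}}\left[\beta+\tan^{-1}\left(\frac{2u_0'(x)\sqrt{M_0-\frac14}}{u_0'(x)+2M_0-4\rho_0(x)}\right)\right],$$ with $\beta=0$ if $u_0'(x)<\min\{0,4(\rho_0(x)-\frac{M_0}{2})\}$, $\beta=\pi$ if $4(\rho_0(x)-\frac{M_0}{2})<u_0'(x)$, and $\beta=2\pi$ if $0\le u_0'(x)<4(\rho_0(x)-\frac{M_0}{2})$.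 When $u_0'(x)+2M_0-4\rho_0(x)=0$, the bracket $[\beta+\tan^{-1}(\cdot)]$ is given its limiting value $\pi/2$ if $u_0'(x)<0$, and is set to $3\pi/2$ if $u_0'(x)\ge0$. -/

import Mathlib

open Set Filter Topology MeasureTheory

noncomputable section

namespace Aggregation

/-- The interaction potential `W(x) = -|x| + |x|²/2`. -/
def W (x : ℝ) : ℝ := -|x| + |x| ^ 2 / 2

/-- The derivative of `W`, off the (null) point `0` where `W` is not differentiable. -/
theorem hasDerivAt_W {x : ℝ} (hx : x ≠ 0) : HasDerivAt W (-Real.sign x + x) x := by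
  have h2 : HasDerivAt (fun y : ℝ => |y| ^ 2 / 2) x x := by
    simpa [sq_abs] using (hasDerivAt_pow 2 x).div_const 2
  rcases lt_or_gt_of_ne hx with h | h
  · rw [Real.sign_of_neg h]
    exact (hasDerivAt_abs_neg h).neg.add h2
  · rw [Real.sign_of_pos h]
    exact (hasDerivAt_abs_pos h).neg.add h2

/-- The nonlocal force field `(∂W ⋆ ρ(·,t))(x)` of a density `ρ` (space first, time second). -/
def force (ρ : ℝ → ℝ → ℝ) (x t : ℝ) : ℝ := ∫ y, deriv W (x - y) * ρ y t

/-- Far-field conditions on `[0, T)`: `ρ|u| → 0` and `ρ|u|² → 0` as `|x| → ∞`, and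
`ρ(x,t) ≤ C / |x|^(2+δ)`, with `C` uniform on every compact time interval `[0, T'] ⊆ [0, T)`. -/
structure FarField (δ T : ℝ) (ρ u : ℝ → ℝ → ℝ) : Prop where
  momentum_decay : ∀ t ∈ Ico 0 T, Tendsto (fun x => ρ x t * |u x t|) (cocompact ℝ) (𝓝 0)
  energy_decay : ∀ t ∈ Ico 0 T, Tendsto (fun x => ρ x t * |u x t| ^ 2) (cocompact ℝ) (𝓝 0)
  density_decay : ∀ T' ∈ Ico 0 T, ∃ C : ℝ, ∀ t ∈ Icc 0 T', ∀ x : ℝ,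
    |x| ^ (2 + δ) * |ρ x t| ≤ C

/-- The momentum equation `u_t + u u_x + u = -∂W ⋆ ρ`, pointwise on `ℝ × (0, T)`. -/
def MomentumEq (T : ℝ) (ρ u : ℝ → ℝ → ℝ) : Prop :=
  ∀ x : ℝ, ∀ t ∈ Ioo 0 T,
    deriv (fun s => u x s) t + u x t * deriv (fun y => u y t) x + u x t = -force ρ x t

/-- Classical solutions on `ℝ × [0, T)`: both `ρ` and `u` are `C¹` (up to `t = 0`) and both
equations hold pointwise. -/
structure IsClassicalSolution (δ : ℝ) (ρ₀ u₀ : ℝ → ℝ) (T : ℝ) (ρ u : ℝ → ℝ → ℝ) : Prop where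
  contDiffOn_ρ : ContDiffOn ℝ 1 (fun p : ℝ × ℝ => ρ p.1 p.2) (univ ×ˢ Ico 0 T)
  contDiffOn_u : ContDiffOn ℝ 1 (fun p : ℝ × ℝ => u p.1 p.2) (univ ×ˢ Ico 0 T)
  initial_ρ : ∀ x, ρ x 0 = ρ₀ x
  initial_u : ∀ x, u x 0 = u₀ x
  continuity_eq : ∀ x : ℝ, ∀ t ∈ Ioo 0 T,
    deriv (fun s => ρ x s) t + deriv (fun y => ρ y t * u y t) x = 0
  momentum_eq : MomentumEq T ρ u
  farField : FarField δ T ρ u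

/-- Solutions on `ℝ × [0, T)` with `u` of class `C¹` and `ρ` continuous: the conservation law
`ρ_t + (ρ u)_x = 0` holds in integral form over every space-time rectangle `[a, b] × [0, t]`
(for `ρ` of class `C¹` this is the pointwise equation). -/
structure IsSolution (δ : ℝ) (ρ₀ u₀ : ℝ → ℝ) (T : ℝ) (ρ u : ℝ → ℝ → ℝ) : Prop where
  continuousOn_ρ : ContinuousOn (fun p : ℝ × ℝ => ρ p.1 p.2) (univ ×ˢ Ico 0 T)
  contDiffOn_u : ContDiffOn ℝ 1 (fun p : ℝ × ℝ => u p.1 p.2) (univ ×ˢ Ico 0 T)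
  initial_ρ : ∀ x, ρ x 0 = ρ₀ x
  initial_u : ∀ x, u x 0 = u₀ x
  conservation : ∀ a b : ℝ, ∀ t ∈ Ico 0 T,
    (∫ x in a..b, ρ x t) = (∫ x in a..b, ρ₀ x) + ∫ s in (0 : ℝ)..t, (ρ a s * u a s - ρ b s * u b s)
  momentum_eq : MomentumEq T ρ u
  farField : FarField δ T ρ u

/-- Finite-time breakdown for a notion of solution `Sol T ρ u` ("`(ρ, u)` is a solution on
`[0, T)`"): there is a solution on some `[0, T)` with `0 < T < ∞`, and none on any `[0, T')` with
`T' > T`; that is, the maximal life span is positive and finite. -/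
def FiniteTimeBreakdown (Sol : ℝ → (ℝ → ℝ → ℝ) → (ℝ → ℝ → ℝ) → Prop) : Prop :=
  ∃ T : ℝ, 0 < T ∧ (∃ ρ u, Sol T ρ u) ∧ ∀ T' : ℝ, T < T' → ¬ ∃ ρ u, Sol T' ρ u

/-! In the inequalities below `M` is the total mass, `r = ρ₀(x)` and `d = u₀'(x)`. -/

/-- The smaller exponent `λ₁ = (1 - √(1 - 4M)) / M`. -/
def lam₁ (M : ℝ) : ℝ := (1 - √(1 - 4 * M)) / M

/-- The larger exponent `λ₂ = (1 + √(1 - 4M)) / M`. -/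
def lam₂ (M : ℝ) : ℝ := (1 + √(1 - 4 * M)) / M

/-- The inequalities for subcritical mass `M < 1/4`. -/
def SubcriticalIneq (M r d : ℝ) : Prop :=
  max d (d + lam₂ M * (M / 2 - r)) < 0 ∧
    |(M / 2 * lam₂ M * d + M - 2 * r) / (2 * r)| ^ lam₁ M ≤
      |(M / 2 * lam₁ M * d + M - 2 * r) / (2 * r)| ^ lam₂ M

/-- The inequalities for critical mass `M = 1/4`. -/
def CriticalIneq (M r d : ℝ) : Prop :=
  max d (M * d + M / 2 - r) < 0 ∧
    M * d / (M * d + M / 2 - r) ≤ Real.log (-((M * d + M / 2 - r) / r))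

/-- The shift `β ∈ {0, π, 2π}`. -/
def betaShift (M r d : ℝ) : ℝ :=
  if d < min 0 (4 * (r - M / 2)) then 0
  else if 4 * (r - M / 2) < d then Real.pi
  else 2 * Real.pi

/-- The angle `β + arctan (2 d √(M - 1/4) / (d + 2M - 4r))`. Where the denominator vanishes it is
given its limiting value: `π/2` if `d < 0`, and `3π/2` otherwise. -/
def angle (M r d : ℝ) : ℝ :=
  if d + 2 * M - 4 * r = 0 then (if d < 0 then Real.pi / 2 else 3 * Real.pi / 2)
  else betaShift M r d + Real.arctan (2 * d * √(M - 1 / 4) / (d + 2 * M - 4 * r))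

/-- The time `t*`. -/
def tStar (M r d : ℝ) : ℝ := 1 / √(M - 1 / 4) * angle M r d

/-- The inequality for supercritical mass `M > 1/4`. -/
def SupercriticalIneq (M r d : ℝ) : Prop :=
  (M - 1 / 4) * (4 * r ^ 2 / M ^ 2 * (M * Real.exp (tStar M r d) / (M - 1 / 4) - 1)
      + (4 * r - M) / M)
    ≤ (d + (M / 2 - r) / M) ^ 2

/-- The breakdown condition on `(ρ₀(x), u₀'(x)) = (r, d)`, split according to the total mass. -/
def BreakdownIneq (M r d : ℝ) : Prop :=
  (M < 1 / 4 ∧ SubcriticalIneq M r d) ∨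
  (M = 1 / 4 ∧ CriticalIneq M r d) ∨
  (1 / 4 < M ∧ SupercriticalIneq M r d)

end Aggregation

end

/-!
In Lagrangian variables the system is a family of linear oscillators. The force field of a density
with total mass `M` is, along a particle path, an affine function of the position `X` and of the mass
to the left of the particle, which is conserved. Hence the Jacobian `w = ∂X/∂x` of the flow map
satisfies `w'' + w' + M w = 2 ρ₀(x)`, `w(0) = 1`, `w'(0) = u₀'(x)`, and `ρ = ρ₀ / w` along the path.
Solutions exist exactly as long as all the Jacobians (`stretch`) are positive, so that breakdown
means that one of them vanishes in finite time, and the explicit inequalities say just that.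

*The inequalities.* `w - 2ρ₀/M` is a damped oscillator `v`; the question is whether it reaches the
level `-2ρ₀/M`. The energy `v'² + M v²` decreases, so only the first minimum of `v` matters
(`IsDampedOscillator.exists_le_iff_of_first_min`). Its depth is computed in the overdamped, critical
and underdamped regimes, which gives `IsDampedOscillator.exists_le_iff_breakdownIneq`.

*Solutions do not outlive a zero of the Jacobian* (`IsSolution.stretch_pos`). For an arbitrary
solution neither the existence of characteristics on the whole time interval nor the conservation of
mass is known beforehand. Both are circumvented by solving the linear Newton equation with the
total mass `∫ ρ(·,t)`, a continuous function of time, as a coefficient: the defects between the path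
obtained and a true characteristic satisfy a homogeneous linear system, hence vanish
(`IsSolution.velocity_eq_and_cumulMass_eq`). Then `ρ w = ρ₀ > 0` along paths shows `w > 0`. A
compactness argument makes this uniform in `x` (`exists_pos_lower_bound`; as `|x| → ∞`, `ρ₀ → 0` and a
degenerate limit would be a double zero of a homogeneous solution). So the flow map is onto, the mass
is conserved, and `w` is the explicit Jacobian.

*Solutions exist while the Jacobian is positive* (`InitialData.exists_isSolution`). The first moment
of the density is explicit, and so is the flow map. By the same compactness it is a diffeomorphism
at each time, also for slightly negative times, which takes care of regularity at `t = 0`; the inverse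
function theorem and changes of variables give the Eulerian equations and the far-field conditions.
-/

noncomputable section

namespace Aggregation

/-! ### Linear systems of ordinary differential equations -/

/-- Uniqueness for a planar linear system whose coefficients are merely bounded: the energy
`(D² + E²) e^{-4Kt}` is nonincreasing. Nothing is asked at the endpoints but continuity. -/
theorem linear_system_eq_zero {S K : ℝ} {D E α β γ η : ℝ → ℝ}
    (hDc : ContinuousOn D (Icc 0 S)) (hEc : ContinuousOn E (Icc 0 S))
    (hD : ∀ t ∈ Ioo 0 S, HasDerivAt D (α t * D t + β t * E t) t)
    (hE : ∀ t ∈ Ioo 0 S, HasDerivAt E (γ t * D t + η t * E t) t)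
    (hα : ∀ t ∈ Ioo 0 S, |α t| ≤ K) (hβ : ∀ t ∈ Ioo 0 S, |β t| ≤ K)
    (hγ : ∀ t ∈ Ioo 0 S, |γ t| ≤ K) (hη : ∀ t ∈ Ioo 0 S, |η t| ≤ K)
    (hD0 : D 0 = 0) (hE0 : E 0 = 0) {t : ℝ} (ht : t ∈ Icc 0 S) : D t = 0 ∧ E t = 0 := by
  have hanti : AntitoneOn (fun s => (D s ^ 2 + E s ^ 2) * Real.exp (-(4 * K) * s)) (Icc 0 S) := by
    have hder : ∀ s ∈ Ioo 0 S, HasDerivAt (fun s => (D s ^ 2 + E s ^ 2) * Real.exp (-(4 * K) * s))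
        ((2 * D s * (α s * D s + β s * E s) + 2 * E s * (γ s * D s + η s * E s)
          - 4 * K * (D s ^ 2 + E s ^ 2)) * Real.exp (-(4 * K) * s)) s := by
      intro s hs
      have h1 := ((hD s hs).pow 2).add ((hE s hs).pow 2)
      have h2 : HasDerivAt (fun s => Real.exp (-(4 * K) * s))
          (Real.exp (-(4 * K) * s) * (-(4 * K))) s := by
        simpa using ((hasDerivAt_id s).const_mul (-(4 * K))).exp
      refine (h1.mul h2).congr_deriv ?_
      simp only [Pi.add_apply, Pi.pow_apply]
      ring
    refine antitoneOn_of_deriv_nonpos (convex_Icc _ _) (by fun_prop) ?_ ?_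
    · rw [interior_Icc]
      exact fun s hs => (hder s hs).differentiableAt.differentiableWithinAt
    · rw [interior_Icc]
      intro s hs
      rw [(hder s hs).deriv]
      refine mul_nonpos_of_nonpos_of_nonneg ?_ (Real.exp_pos _).le
      have h1 := abs_le.1 (hα s hs)
      have h2 := abs_le.1 (hβ s hs)
      have h3 := abs_le.1 (hγ s hs)
      have h4 := abs_le.1 (hη s hs)
      nlinarith [mul_nonneg (sub_nonneg.2 h1.2) (sq_nonneg (D s)),
        mul_nonneg (sub_nonneg.2 h4.2) (sq_nonneg (E s)),
        mul_nonneg (sub_nonneg.2 h2.2) (sq_nonneg (D s + E s)),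
        mul_nonneg (sub_nonneg.2 h3.2) (sq_nonneg (D s + E s)),
        mul_nonneg (neg_le_iff_add_nonneg.1 h2.1) (sq_nonneg (D s - E s)),
        mul_nonneg (neg_le_iff_add_nonneg.1 h3.1) (sq_nonneg (D s - E s))]
  have h := hanti (left_mem_Icc.2 (ht.1.trans ht.2)) ht ht.1
  simp only [hD0, hE0] at h
  have h' : D t ^ 2 + E t ^ 2 ≤ 0 := by
    by_contra! hlt
    have := mul_pos hlt (Real.exp_pos (-(4 * K) * t))
    simp only [ne_eq, OfNat.ofNat_ne_zero, not_false_eq_true, zero_pow, add_zero, zero_mul] at h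
    linarith
  constructor <;> nlinarith [sq_nonneg (D t), sq_nonneg (E t)]

/-- Truncation of a real number to `[-R, R]`. -/
def clamp (R x : ℝ) : ℝ := max (-R) (min x R)

theorem clamp_of_abs_le {R x : ℝ} (h : |x| ≤ R) : clamp R x = x := by
  have := abs_le.1 h
  rw [clamp, min_eq_left this.2, max_eq_right this.1]

theorem abs_clamp_le_abs {R x : ℝ} (hR : 0 ≤ R) : |clamp R x| ≤ |x| := by
  unfold clamp
  rcases le_total x R with h | h <;> rcases le_total (-R) x with h' | h' <;>
    rw [abs_le] <;> constructor <;>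
    rcases abs_cases x with ⟨h1, h2⟩ | ⟨h1, h2⟩ <;> grind

theorem abs_clamp_le {R x : ℝ} (hR : 0 ≤ R) : |clamp R x| ≤ R := by
  unfold clamp
  rw [abs_le]
  constructor <;> grind

theorem abs_clamp_sub_clamp_le (R x y : ℝ) : |clamp R x - clamp R y| ≤ |x - y| := by
  unfold clamp
  exact (abs_max_sub_max_le_max _ _ _ _).trans (max_le (by simp)
    ((abs_min_sub_min_le_max _ _ _ _).trans (by simp)))

/-- Global existence for `y'' + y' + μ(t) y = f(t)` on a compact time interval. The Picard-Lindelöf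
theorem is applied to the truncation at height `R` of the vector field, which is bounded, and
Grönwall's inequality shows that the truncation is not felt if `R` is large. -/
theorem exists_damped {S : ℝ} (hS : 0 ≤ S) {μ f : ℝ → ℝ} (hμ : ContinuousOn μ (Icc 0 S))
    (hf : ContinuousOn f (Icc 0 S)) (a b : ℝ) :
    ∃ y y' : ℝ → ℝ, y 0 = a ∧ y' 0 = b ∧ ContinuousOn y (Icc 0 S) ∧ ContinuousOn y' (Icc 0 S) ∧
      (∀ t ∈ Ioo 0 S, HasDerivAt y (y' t) t) ∧
      ∀ t ∈ Ioo 0 S, HasDerivAt y' (-y' t - μ t * y t + f t) t := by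
  obtain ⟨K₀, hK₀⟩ := isCompact_Icc.exists_bound_of_continuousOn hμ
  obtain ⟨F₀, hF₀⟩ := isCompact_Icc.exists_bound_of_continuousOn hf
  have h0S : (0 : ℝ) ∈ Icc 0 S := left_mem_Icc.2 hS
  have hK₀0 : 0 ≤ K₀ := (norm_nonneg _).trans (hK₀ 0 h0S)
  have hF₀0 : 0 ≤ F₀ := (norm_nonneg _).trans (hF₀ 0 h0S)
  set R := gronwallBound ‖(a, b)‖ (1 + K₀) F₀ S with hRdef
  have hmono : Monotone (gronwallBound ‖(a, b)‖ (1 + K₀) F₀) :=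
    gronwallBound_mono (norm_nonneg _) hF₀0 (by positivity)
  have hR : 0 ≤ R := by
    have := hmono hS
    rw [gronwallBound_x0] at this
    exact (norm_nonneg _).trans this
  set v : ℝ → ℝ × ℝ → ℝ × ℝ := fun t z =>
    (clamp R z.2, -clamp R z.2 - μ t * clamp R z.1 + f t) with hv
  have hbound : ∀ t ∈ Icc 0 S, ∀ z : ℝ × ℝ, ∀ B, |clamp R z.1| ≤ B → |clamp R z.2| ≤ B →
      ‖v t z‖ ≤ (1 + K₀) * B + F₀ := by
    intro t ht z B h1 h2
    have hB : 0 ≤ B := (abs_nonneg _).trans h1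
    have hm : |μ t| ≤ K₀ := hK₀ t ht
    have hf' : |f t| ≤ F₀ := hF₀ t ht
    have h3 : |μ t * clamp R z.1| ≤ K₀ * B := by
      rw [abs_mul]
      exact mul_le_mul hm h1 (abs_nonneg _) hK₀0
    have hKB : 0 ≤ K₀ * B := by positivity
    rw [Prod.norm_def, max_le_iff]
    simp only [hv, Real.norm_eq_abs]
    rw [abs_le] at *
    constructor
    · constructor <;> nlinarith
    · rw [abs_le]
      constructor <;> nlinarith
  obtain ⟨k, hk⟩ : ∃ k : NNReal, (k : ℝ) = 1 + K₀ := ⟨⟨1 + K₀, by positivity⟩, rfl⟩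
  obtain ⟨l, hl⟩ : ∃ l : NNReal, (l : ℝ) = (1 + K₀) * R + F₀ := ⟨⟨_, by positivity⟩, rfl⟩
  obtain ⟨A, hA⟩ : ∃ A : NNReal, (A : ℝ) = ((1 + K₀) * R + F₀) * S := ⟨⟨_, by positivity⟩, rfl⟩
  have hP : IsPicardLindelof v (⟨0, h0S⟩ : Icc (0 : ℝ) S) (a, b) A 0 l k := by
    refine ⟨fun t ht => ?_, fun z _ => ?_, fun t ht z _ => ?_, ?_⟩
    · refine LipschitzOnWith.of_dist_le_mul fun z _ w _ => ?_
      rw [dist_eq_norm, dist_eq_norm]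
      have hz1 : |z.1 - w.1| ≤ ‖z - w‖ := norm_fst_le (z - w)
      have hz2 : |z.2 - w.2| ≤ ‖z - w‖ := norm_snd_le (z - w)
      have h1 := (abs_clamp_sub_clamp_le R z.1 w.1).trans hz1
      have h2 := (abs_clamp_sub_clamp_le R z.2 w.2).trans hz2
      have hm : |μ t| ≤ K₀ := hK₀ t ht
      have hn := norm_nonneg (z - w)
      have h3 : |μ t * (clamp R z.1 - clamp R w.1)| ≤ K₀ * ‖z - w‖ := by
        rw [abs_mul]
        exact mul_le_mul hm h1 (abs_nonneg _) hK₀0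
      have hKB : 0 ≤ K₀ * ‖z - w‖ := by positivity
      generalize ‖z - w‖ = N at *
      rw [Prod.norm_def, max_le_iff]
      simp only [hv, Real.norm_eq_abs, Prod.fst_sub, Prod.snd_sub, hk]
      rw [abs_le] at h2 h3
      constructor <;> rw [abs_le] <;> constructor <;> nlinarith
    · simp only [hv]
      fun_prop
    · rw [hl]
      exact hbound t ht z R (abs_clamp_le hR) (abs_clamp_le hR)
    · simp [hS, hl, hA]
  obtain ⟨α, hα0, hα⟩ := hP.exists_eq_forall_mem_Icc_hasDerivWithinAt₀
  have hαc : ContinuousOn α (Icc 0 S) := fun t ht => (hα t ht).continuousWithinAt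
  have hαR : ∀ t ∈ Icc 0 S, ‖α t‖ ≤ R := by
    intro t ht
    have h := norm_le_gronwallBound_of_norm_deriv_right_le (δ := ‖(a, b)‖) (K := 1 + K₀) (ε := F₀)
      hαc (f' := fun t => v t (α t))
      (fun t ht => ((hα t ⟨ht.1, ht.2.le⟩).mono_of_mem_nhdsWithin (Icc_mem_nhdsGE_of_mem ht)))
      (by rw [show α 0 = (a, b) from hα0]) (fun t ht => ?_) t ht
    · refine h.trans ?_
      rw [hRdef]
      exact hmono (by simpa using ht.2)
    · exact hbound t ⟨ht.1, ht.2.le⟩ _ _ ((abs_clamp_le_abs hR).trans (norm_fst_le (α t)))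
        ((abs_clamp_le_abs hR).trans (norm_snd_le (α t)))
  have hder : ∀ t ∈ Ioo 0 S, HasDerivAt α ((α t).2, -(α t).2 - μ t * (α t).1 + f t) t := by
    intro t ht
    have ht' := Ioo_subset_Icc_self ht
    have h := (hα t ht').hasDerivAt (Icc_mem_nhds ht.1 ht.2)
    have h1 := (norm_fst_le (α t)).trans (hαR t ht')
    have h2 := (norm_snd_le (α t)).trans (hαR t ht')
    simpa only [hv, clamp_of_abs_le h1, clamp_of_abs_le h2] using h
  have hα0' : α 0 = (a, b) := hα0
  refine ⟨fun t => (α t).1, fun t => (α t).2, by simp [hα0'], by simp [hα0'], by fun_prop,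
    by fun_prop, fun t ht => ?_, fun t ht => ?_⟩
  · exact (hasFDerivAt_fst.comp_hasDerivAt t (hder t ht) :)
  · exact (hasFDerivAt_snd.comp_hasDerivAt t (hder t ht) :)

/-! ### The damped oscillator -/

/-- `v` solves `v'' + v' + M v = 0` on the real line, and `v'` is its derivative. -/
structure IsDampedOscillator (M : ℝ) (v v' : ℝ → ℝ) : Prop where
  hasDerivAt : ∀ t, HasDerivAt v (v' t) t
  hasDerivAt' : ∀ t, HasDerivAt v' (-v' t - M * v t) t

namespace IsDampedOscillator

variable {M : ℝ} {v v' w w' : ℝ → ℝ}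

theorem continuous (h : IsDampedOscillator M v v') : Continuous v :=
  continuous_iff_continuousAt.2 fun t => (h.hasDerivAt t).continuousAt

theorem continuous' (h : IsDampedOscillator M v v') : Continuous v' :=
  continuous_iff_continuousAt.2 fun t => (h.hasDerivAt' t).continuousAt

theorem eq_of_initial (h : IsDampedOscillator M v v') (k : IsDampedOscillator M w w')
    (h0 : v 0 = w 0) (h0' : v' 0 = w' 0) {t : ℝ} (ht : 0 ≤ t) : v t = w t ∧ v' t = w' t := by
  have hc := h.continuous
  have hc' := h.continuous'
  have kc := k.continuous
  have kc' := k.continuous'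
  have key := linear_system_eq_zero (S := t) (K := 1 + |M|) (D := fun s => v s - w s)
    (E := fun s => v' s - w' s) (α := fun _ => 0) (β := fun _ => 1) (γ := fun _ => -M)
    (η := fun _ => -1) (by fun_prop) (by fun_prop)
    (fun s _ => ((h.hasDerivAt s).sub (k.hasDerivAt s)).congr_deriv (by ring))
    (fun s _ => ((h.hasDerivAt' s).sub (k.hasDerivAt' s)).congr_deriv (by ring))
    (fun s _ => by simp; positivity) (fun s _ => by simp)
    (fun s _ => by simp) (fun s _ => by simp) (by simp [h0]) (by simp [h0'])
    (right_mem_Icc.2 ht)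
  exact ⟨sub_eq_zero.1 key.1, sub_eq_zero.1 key.2⟩

theorem linear_combination (h : IsDampedOscillator M v v') (k : IsDampedOscillator M w w')
    (a b : ℝ) : IsDampedOscillator M (fun t => a * v t + b * w t)
      (fun t => a * v' t + b * w' t) where
  hasDerivAt t := ((h.hasDerivAt t).const_mul a).add ((k.hasDerivAt t).const_mul b)
  hasDerivAt' t := (((h.hasDerivAt' t).const_mul a).add
    ((k.hasDerivAt' t).const_mul b)).congr_deriv (by ring)

theorem deriv_self (h : IsDampedOscillator M v v') :
    IsDampedOscillator M v' (fun t => -v' t - M * v t) where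
  hasDerivAt := h.hasDerivAt'
  hasDerivAt' t := ((h.hasDerivAt' t).neg.sub ((h.hasDerivAt t).const_mul M))

/-- The energy `v'² + M v²` decreases, so that after a critical point at a negative level the
oscillator never gets below that level again. -/
theorem le_of_deriv_eq_zero (h : IsDampedOscillator M v v') (hM : 0 < M) {t₁ t : ℝ}
    (h1 : v' t₁ = 0) (hv1 : v t₁ ≤ 0) (ht : t₁ ≤ t) : v t₁ ≤ v t := by
  have hanti : Antitone fun s => v' s ^ 2 + M * v s ^ 2 := by
    have hd : ∀ s, HasDerivAt (fun s => v' s ^ 2 + M * v s ^ 2) (-2 * v' s ^ 2) s := fun s =>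
      (((h.hasDerivAt' s).pow 2).add (((h.hasDerivAt s).pow 2).const_mul M)).congr_deriv
        (by push_cast; ring)
    refine antitone_of_deriv_nonpos (fun s => (hd s).differentiableAt) fun s => ?_
    rw [(hd s).deriv]
    nlinarith [sq_nonneg (v' s)]
  have h2 := hanti ht
  simp only [h1] at h2
  have h3 : v t ^ 2 ≤ v t₁ ^ 2 := by
    have : M * v t ^ 2 ≤ M * v t₁ ^ 2 := by nlinarith [sq_nonneg (v' t)]
    exact le_of_mul_le_mul_left this hM
  nlinarith [abs_le_of_sq_le_sq' (by simpa using h3 : v t ^ 2 ≤ (-v t₁) ^ 2) (by linarith)]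

/-- The quadratic form `v'² + v v' + M v²` decays exactly like `e^{-t}`. -/
theorem quadratic_form_eq (h : IsDampedOscillator M v v') (t : ℝ) :
    (v' t ^ 2 + v t * v' t + M * v t ^ 2) * Real.exp t
      = v' 0 ^ 2 + v 0 * v' 0 + M * v 0 ^ 2 := by
  have hd : ∀ s, HasDerivAt (fun s => (v' s ^ 2 + v s * v' s + M * v s ^ 2) * Real.exp s) 0 s :=
    fun s => (((((h.hasDerivAt' s).pow 2).add ((h.hasDerivAt s).mul (h.hasDerivAt' s))).add
      (((h.hasDerivAt s).pow 2).const_mul M)).mul (Real.hasDerivAt_exp s)).congr_deriv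
        (by simp only [Pi.add_apply, Pi.mul_apply, Pi.pow_apply]; push_cast; ring)
  simpa using is_const_of_deriv_eq_zero (fun s => (hd s).differentiableAt)
    (fun s => (hd s).deriv) t 0

/-- If `t₁` is the first minimum of the oscillator, then it reaches the level `-b` in positive time
if and only if it is below that level at `t₁`. -/
theorem exists_le_iff_of_first_min (h : IsDampedOscillator M v v') (hM : 0 < M) {b t₁ : ℝ}
    (h0 : 0 < b + v 0) (ht₁ : 0 < t₁) (h1 : v' t₁ = 0) (hv1 : v t₁ ≤ 0)
    (hmin : ∀ t ∈ Icc 0 t₁, min (v 0) (v t₁) ≤ v t) :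
    (∃ t > 0, b + v t ≤ 0) ↔ v t₁ ≤ -b := by
  refine ⟨fun ⟨t, ht, hbt⟩ => ?_, fun hb => ⟨t₁, ht₁, by linarith⟩⟩
  rcases le_total t t₁ with htt | htt
  · rcases min_le_iff.1 (hmin t ⟨ht.le, htt⟩) with h2 | h2 <;> linarith
  · linarith [h.le_of_deriv_eq_zero hM h1 hv1 htt]

end IsDampedOscillator

theorem hasDerivAt_exp_const_mul (k t : ℝ) :
    HasDerivAt (fun t => Real.exp (k * t)) (k * Real.exp (k * t)) t := by
  simpa [mul_comm] using ((hasDerivAt_id t).const_mul k).exp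

theorem isDampedOscillator_exp {k M : ℝ} (hk : k ^ 2 + k + M = 0) :
    IsDampedOscillator M (fun t => Real.exp (k * t)) (fun t => k * Real.exp (k * t)) where
  hasDerivAt := hasDerivAt_exp_const_mul k
  hasDerivAt' t := ((hasDerivAt_exp_const_mul k t).const_mul k).congr_deriv
    (by linear_combination Real.exp (k * t) * hk)

theorem isDampedOscillator_critical (a d : ℝ) :
    IsDampedOscillator (1 / 4) (fun t => Real.exp (-(1 / 2) * t) * (a + (d + a / 2) * t))
      (fun t => Real.exp (-(1 / 2) * t) * (d - (d + a / 2) / 2 * t)) where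
  hasDerivAt t := ((hasDerivAt_exp_const_mul (-(1 / 2)) t).mul
    (((hasDerivAt_id t).const_mul (d + a / 2)).const_add a)).congr_deriv (by simp only [id]; ring)
  hasDerivAt' t := ((hasDerivAt_exp_const_mul (-(1 / 2)) t).mul
    (((hasDerivAt_id t).const_mul ((d + a / 2) / 2)).const_sub d)).congr_deriv
      (by simp only [id]; ring)

theorem isDampedOscillator_trig {ω : ℝ} (hω : ω ≠ 0) (a d : ℝ) :
    IsDampedOscillator (ω ^ 2 + 1 / 4)
      (fun t => Real.exp (-(1 / 2) * t)
        * (a * Real.cos (ω * t) + (d + a / 2) / ω * Real.sin (ω * t)))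
      (fun t => Real.exp (-(1 / 2) * t) * (d * Real.cos (ω * t)
        - (d + 2 * (ω ^ 2 + 1 / 4) * a) / (2 * ω) * Real.sin (ω * t))) := by
  have hc : ∀ t, HasDerivAt (fun t => Real.cos (ω * t)) (-(ω * Real.sin (ω * t))) t := fun t => by
    simpa [mul_comm] using ((hasDerivAt_id t).const_mul ω).cos
  have hs : ∀ t, HasDerivAt (fun t => Real.sin (ω * t)) (ω * Real.cos (ω * t)) t := fun t => by
    simpa [mul_comm] using ((hasDerivAt_id t).const_mul ω).sin
  constructor
  · exact fun t => ((hasDerivAt_exp_const_mul (-(1 / 2)) t).mul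
      (((hc t).const_mul a).add ((hs t).const_mul ((d + a / 2) / ω)))).congr_deriv
        (by simp only [Pi.add_apply]; field_simp; ring)
  · exact fun t => ((hasDerivAt_exp_const_mul (-(1 / 2)) t).mul
      (((hc t).const_mul d).sub ((hs t).const_mul
        ((d + 2 * (ω ^ 2 + 1 / 4) * a) / (2 * ω))))).congr_deriv
        (by simp only [Pi.sub_apply]; field_simp; ring)

theorem exists_isDampedOscillator (M : ℝ) :
    ∃ φ φ' : ℝ → ℝ, IsDampedOscillator M φ φ' ∧ φ 0 = 0 ∧ φ' 0 = 1 := by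
  rcases lt_trichotomy M (1 / 4) with hM | rfl | hM
  · set s := √(1 - 4 * M) with hs
    have hs0 : 0 < s := Real.sqrt_pos.2 (by linarith)
    have hs2 : s ^ 2 = 1 - 4 * M := Real.sq_sqrt (by linarith)
    refine ⟨_, _, (isDampedOscillator_exp (k := (-1 + s) / 2) (M := M)
      (by linear_combination hs2 / 4)).linear_combination
      (isDampedOscillator_exp (k := (-1 - s) / 2) (M := M) (by linear_combination hs2 / 4))
      (1 / s) (-(1 / s)), by simp, ?_⟩
    simp
    field_simp
    ring
  · exact ⟨_, _, isDampedOscillator_critical 0 1, by simp, by simp⟩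
  · set ω := √(M - 1 / 4) with hω
    have hω0 : 0 < ω := Real.sqrt_pos.2 (by linarith)
    have hω2 : ω ^ 2 = M - 1 / 4 := Real.sq_sqrt (by linarith)
    have h := isDampedOscillator_trig hω0.ne' 0 1
    rw [hω2, sub_add_cancel] at h
    exact ⟨_, _, h, by simp, by simp⟩

/-! ### When a damped oscillator reaches a negative level -/

namespace IsDampedOscillator

variable {v v' : ℝ → ℝ} {b d : ℝ}

/-- Overdamped case: the characteristic roots are `-p` and `-q`. The oscillator is
`-A e^{-pt} + B e^{-qt}`; it has a negative minimum, at `e^{(q-p)t} = qB/(pA)`, exactly when `A` and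
the initial velocity have the right sign. -/
theorem exists_le_iff_overdamped {p q : ℝ} (hp : 0 < p) (hpq : p < q) (hpq1 : p + q = 1)
    (h : IsDampedOscillator (p * q) v v') (hb : 0 < b) (hv0 : v 0 = 1 - b) (hv0' : v' 0 = d) :
    (∃ t > 0, b + v t ≤ 0) ↔ d < 0 ∧ d + q * (1 - b) < 0 ∧
      p * Real.log (-(d + p * (1 - b)) / (p * b)) ≤ q * Real.log (-(d + q * (1 - b)) / (q * b)) := by
  have hq : 0 < q := hp.trans hpq
  have hs : 0 < q - p := sub_pos.2 hpq
  set A := -(d + q * (1 - b)) / (q - p) with hA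
  set B := -(d + p * (1 - b)) / (q - p) with hB
  have hAs : A * (q - p) = -(d + q * (1 - b)) := div_mul_cancel₀ _ hs.ne'
  have hBs : B * (q - p) = -(d + p * (1 - b)) := div_mul_cancel₀ _ hs.ne'
  have hAB : B - A = 1 - b := by
    have : (B - A) * (q - p) = (1 - b) * (q - p) := by linear_combination hBs - hAs
    exact mul_right_cancel₀ hs.ne' this
  have hABd : p * A - q * B = d := by
    have : (p * A - q * B) * (q - p) = d * (q - p) := by linear_combination p * hAs - q * hBs
    exact mul_right_cancel₀ hs.ne' this
  have hexp := (isDampedOscillator_exp (k := -p) (M := p * q)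
    (by linear_combination p * hpq1)).linear_combination
    (isDampedOscillator_exp (k := -q) (M := p * q) (by linear_combination q * hpq1)) (-A) B
  have hv : ∀ t, 0 ≤ t → v t = -A * Real.exp (-p * t) + B * Real.exp (-q * t) ∧
      v' t = p * A * Real.exp (-p * t) - q * B * Real.exp (-q * t) := fun t ht => by
    have := h.eq_of_initial hexp (by simp; linarith) (by simp; linarith) ht
    exact ⟨this.1, this.2.trans (by ring)⟩
  have hcmp : ∀ t, 0 ≤ t → Real.exp (-q * t) ≤ Real.exp (-p * t) := fun t ht =>
    Real.exp_le_exp.2 (by nlinarith)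
  by_cases hA0 : 0 < A
  swap
  · -- The slow mode has a nonnegative coefficient, so `v t ≥ (1 - b) e^{-qt}`.
    have hcond : ¬ d + q * (1 - b) < 0 := fun hlt => hA0 (div_pos (by linarith) hs)
    refine iff_of_false ?_ (fun hh => hcond hh.2.1)
    rintro ⟨t, ht, hbt⟩
    rw [(hv t ht.le).1] at hbt
    have h1 := hcmp t ht.le
    have h2 : Real.exp (-q * t) ≤ 1 := Real.exp_le_one_iff.2 (by nlinarith)
    have h3 := Real.exp_pos (-q * t)
    rw [show B = A + (1 - b) by linarith] at hbt
    nlinarith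
  by_cases hd : d < 0
  swap
  · -- The oscillator never decreases.
    refine iff_of_false ?_ (fun hh => hd hh.1)
    rintro ⟨t, ht, hbt⟩
    have hmono : MonotoneOn v (Ici 0) := by
      refine monotoneOn_of_deriv_nonneg (convex_Ici _) h.continuous.continuousOn
        (fun s _ => (h.hasDerivAt s).differentiableAt.differentiableWithinAt) fun s hs' => ?_
      rw [interior_Ici] at hs'
      rw [(h.hasDerivAt s).deriv, (hv s (le_of_lt hs')).2]
      have h1 := hcmp s (le_of_lt hs')
      have h3 := Real.exp_pos (-q * s)
      have h4 : 0 < p * A := mul_pos hp hA0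
      nlinarith [mul_le_mul_of_nonneg_left h1 h4.le]
    have := hmono (mem_Ici.2 le_rfl) (mem_Ici.2 (le_of_lt ht)) (le_of_lt ht)
    linarith
  have hB0 : 0 < B := by
    by_contra! hB0
    nlinarith [mul_pos hp hA0]
  have hpA : 0 < p * A := mul_pos hp hA0
  have hqB : 0 < q * B := mul_pos hq hB0
  have hratio : 1 < q * B / (p * A) := by
    rw [lt_div_iff₀ hpA]
    linarith
  set t₁ := Real.log (q * B / (p * A)) / (q - p) with ht₁
  have ht₁0 : 0 < t₁ := div_pos (Real.log_pos hratio) hs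
  have hderiv : ∀ t, 0 ≤ t →
      v' t = p * A * Real.exp (-q * t) * (Real.exp ((q - p) * t) - q * B / (p * A)) := by
    intro t ht
    have h1 : Real.exp (-p * t) = Real.exp (-q * t) * Real.exp ((q - p) * t) := by
      rw [← Real.exp_add]
      ring_nf
    rw [(hv t ht).2, h1]
    field_simp
  have hexp1 : Real.exp ((q - p) * t₁) = q * B / (p * A) := by
    rw [ht₁, mul_div_cancel₀ _ hs.ne', Real.exp_log (by positivity)]
  have hv't₁ : v' t₁ = 0 := by rw [hderiv t₁ ht₁0.le, hexp1, sub_self, mul_zero]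
  have hmin : ∀ t ∈ Icc 0 t₁, min (v 0) (v t₁) ≤ v t := by
    intro t ht
    have hanti : AntitoneOn v (Icc 0 t₁) := by
      refine antitoneOn_of_deriv_nonpos (convex_Icc _ _) h.continuous.continuousOn
        (fun s _ => (h.hasDerivAt s).differentiableAt.differentiableWithinAt) fun s hs' => ?_
      rw [interior_Icc] at hs'
      rw [(h.hasDerivAt s).deriv, hderiv s hs'.1.le]
      refine mul_nonpos_of_nonneg_of_nonpos (by positivity) ?_
      rw [← hexp1, sub_nonpos, Real.exp_le_exp]
      nlinarith [hs'.2]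
    exact min_le_of_right_le (hanti ht (right_mem_Icc.2 ht₁0.le) ht.2)
  set α := -(d + q * (1 - b)) / (q * b) with hα
  set β := -(d + p * (1 - b)) / (p * b) with hβ
  have hα' : α = A * (q - p) / (q * b) := by rw [hAs]
  have hβ' : β = B * (q - p) / (p * b) := by rw [hBs]
  have hα0 : 0 < α := by rw [hα']; positivity
  have hβ0 : 0 < β := by rw [hβ']; positivity
  have hvt₁ : v t₁ = -b * (α * Real.exp (-p * t₁)) := by
    have h1 : Real.exp (-p * t₁) = Real.exp (-q * t₁) * (q * B / (p * A)) := by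
      rw [← hexp1, ← Real.exp_add]
      ring_nf
    rw [(hv t₁ ht₁0.le).1, h1, hα']
    field_simp
    ring
  have hlog : Real.log (q * B / (p * A)) = Real.log β - Real.log α := by
    rw [← Real.log_div hβ0.ne' hα0.ne', hα', hβ']
    congr 1
    field_simp
  rw [h.exists_le_iff_of_first_min (mul_pos hp hq) (by linarith) ht₁0 hv't₁
    (by rw [hvt₁, neg_mul, neg_nonpos]; positivity) hmin]
  have hstep : v t₁ ≤ -b ↔ 1 ≤ α * Real.exp (-p * t₁) := by
    rw [hvt₁, neg_mul, neg_le_neg_iff, le_mul_iff_one_le_right hb]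
  have hcond : d + q * (1 - b) < 0 := by linarith [mul_pos hA0 hs]
  rw [hstep, ← Real.log_nonneg_iff (by positivity), Real.log_mul hα0.ne' (Real.exp_pos _).ne',
    Real.log_exp, ht₁, hlog]
  simp only [hd, hcond, true_and]
  have : Real.log α + -p * ((Real.log β - Real.log α) / (q - p))
      = (q * Real.log α - p * Real.log β) / (q - p) := by
    field_simp
    ring
  rw [this, le_div_iff₀ hs, zero_mul, sub_nonneg]

/-- Critically damped case. The oscillator is `(1 - b + B t) e^{-t/2}` with `B = d + (1 - b) / 2`; it
has a negative minimum, at time `2d/B`, exactly when `B` and `d` are negative. -/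
theorem exists_le_iff_critical (h : IsDampedOscillator (1 / 4) v v') (hb : 0 < b)
    (hv0 : v 0 = 1 - b) (hv0' : v' 0 = d) :
    (∃ t > 0, b + v t ≤ 0) ↔ d < 0 ∧ d + (1 - b) / 2 < 0 ∧
      d / (d + (1 - b) / 2) ≤ Real.log (-(d + (1 - b) / 2) * 2 / b) := by
  set B := d + (1 - b) / 2 with hB
  have hv : ∀ t, 0 ≤ t → v t = Real.exp (-(1 / 2) * t) * ((1 - b) + B * t) ∧
      v' t = Real.exp (-(1 / 2) * t) * (d - B / 2 * t) := fun t ht =>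
    h.eq_of_initial (isDampedOscillator_critical (1 - b) d) (by simp [hv0]) (by simp [hv0']) ht
  by_cases hB0 : B < 0
  swap
  · -- `v t ≥ (1 - b) e^{-t/2}`.
    refine iff_of_false ?_ (fun hh => hB0 hh.2.1)
    rintro ⟨t, ht, hbt⟩
    rw [(hv t ht.le).1] at hbt
    have h2 : Real.exp (-(1 / 2) * t) ≤ 1 := Real.exp_le_one_iff.2 (by linarith)
    have h3 := Real.exp_pos (-(1 / 2) * t)
    nlinarith [mul_nonneg h3.le (mul_nonneg (not_lt.1 hB0) ht.le)]
  by_cases hd : d < 0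
  swap
  · -- The oscillator never decreases.
    refine iff_of_false ?_ (fun hh => hd hh.1)
    rintro ⟨t, ht, hbt⟩
    have hmono : MonotoneOn v (Ici 0) := by
      refine monotoneOn_of_deriv_nonneg (convex_Ici _) h.continuous.continuousOn
        (fun s _ => (h.hasDerivAt s).differentiableAt.differentiableWithinAt) fun s hs' => ?_
      rw [interior_Ici] at hs'
      rw [(h.hasDerivAt s).deriv, (hv s (le_of_lt hs')).2]
      exact mul_nonneg (Real.exp_pos _).le (by nlinarith [mem_Ioi.1 hs'])
    have := hmono (mem_Ici.2 le_rfl) (mem_Ici.2 (le_of_lt ht)) (le_of_lt ht)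
    linarith
  set t₁ := 2 * d / B with ht₁
  have ht₁0 : 0 < t₁ := div_pos_of_neg_of_neg (by linarith) hB0
  have hBt₁ : B * t₁ = 2 * d := by rw [ht₁, mul_div_cancel₀ _ hB0.ne]
  have hv't₁ : v' t₁ = 0 := by
    rw [(hv t₁ ht₁0.le).2]
    linear_combination -(Real.exp (-(1 / 2) * t₁) / 2) * hBt₁
  have hmin : ∀ t ∈ Icc 0 t₁, min (v 0) (v t₁) ≤ v t := by
    intro t ht
    have hanti : AntitoneOn v (Icc 0 t₁) := by
      refine antitoneOn_of_deriv_nonpos (convex_Icc _ _) h.continuous.continuousOn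
        (fun s _ => (h.hasDerivAt s).differentiableAt.differentiableWithinAt) fun s hs' => ?_
      rw [interior_Icc] at hs'
      rw [(h.hasDerivAt s).deriv, (hv s hs'.1.le).2]
      exact mul_nonpos_of_nonneg_of_nonpos (Real.exp_pos _).le (by nlinarith [hs'.2])
    exact min_le_of_right_le (hanti ht (right_mem_Icc.2 ht₁0.le) ht.2)
  have hvt₁ : v t₁ = 2 * B * Real.exp (-(d / B)) := by
    rw [(hv t₁ ht₁0.le).1, hBt₁, ht₁, hB,
      show -(1 / 2) * (2 * d / (d + (1 - b) / 2)) = -(d / (d + (1 - b) / 2)) by ring]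
    ring
  have hexp := Real.exp_pos (-(d / B))
  rw [h.exists_le_iff_of_first_min (by norm_num) (by linarith) ht₁0 hv't₁
    (by rw [hvt₁]; nlinarith) hmin]
  simp only [hd, hB0, true_and]
  rw [Real.le_log_iff_exp_le (div_pos (by linarith) hb), le_div_iff₀ hb, hvt₁, Real.exp_neg,
    ← div_eq_mul_inv, div_le_iff₀ (Real.exp_pos _)]
  constructor <;> intro hh <;> linarith

/-- Underdamped case. Writing the velocity as `κ e^{-t/2} sin (ω t - θ)` with `0 < θ ≤ 2π`, the
first minimum is at time `θ / ω`. -/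
theorem exists_le_iff_underdamped {ω θ κ : ℝ} (hω : 0 < ω)
    (h : IsDampedOscillator (ω ^ 2 + 1 / 4) v v') (hb : 0 < b) (hv0 : v 0 = 1 - b)
    (hv0' : v' 0 = d) (hκ : 0 < κ) (hθ : θ ∈ Ioc 0 (2 * Real.pi)) (hd : d = -κ * Real.sin θ)
    (hf : (d + 2 * (ω ^ 2 + 1 / 4) * (1 - b)) / (2 * ω) = -κ * Real.cos θ) :
    (∃ t > 0, b + v t ≤ 0) ↔
      (ω ^ 2 + 1 / 4) * b ^ 2 * Real.exp (1 / ω * θ) ≤ (d + (1 - b) / 2) ^ 2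
        + ω ^ 2 * (1 - b) ^ 2 := by
  have hM : 0 < ω ^ 2 + 1 / 4 := by positivity
  have hv : ∀ t, 0 ≤ t → v' t = κ * Real.exp (-(1 / 2) * t) * Real.sin (ω * t - θ) := fun t ht => by
    rw [(h.eq_of_initial (isDampedOscillator_trig hω.ne' (1 - b) d)
      (by simp [hv0]) (by simp [hv0']) ht).2, hf, Real.sin_sub]
    linear_combination Real.exp (-(1 / 2) * t) * Real.cos (ω * t) * hd
  set t₁ := 1 / ω * θ with ht₁
  have ht₁0 : 0 < t₁ := mul_pos (by positivity) hθ.1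
  have hωt₁ : ω * t₁ = θ := by rw [ht₁]; field_simp
  have hv't₁ : v' t₁ = 0 := by rw [hv t₁ ht₁0.le, hωt₁]; simp
  have hvt₁ : v t₁ < 0 := by
    have h1 : HasDerivAt (fun t => κ * Real.exp (-(1 / 2) * t) * Real.sin (ω * t - θ))
        (κ * Real.exp (-(1 / 2) * t₁) * ω) t₁ := by
      have h2 := ((hasDerivAt_exp_const_mul (-(1 / 2)) t₁).const_mul κ).mul
        (((hasDerivAt_id t₁).const_mul ω).sub_const θ).sin
      refine h2.congr_deriv ?_
      simp [hωt₁]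
    have h2 := (h.hasDerivAt' t₁).congr_of_eventuallyEq (f₁ := fun t =>
      κ * Real.exp (-(1 / 2) * t) * Real.sin (ω * t - θ))
      ((lt_mem_nhds ht₁0).mono fun t ht => (hv t ht.le).symm)
    have h3 := h1.unique h2
    rw [hv't₁] at h3
    have h4 : 0 < κ * Real.exp (-(1 / 2) * t₁) * ω := by positivity
    by_contra! h5
    nlinarith [mul_nonneg hM.le h5]
  have hanti : ∀ c, 0 ≤ c → θ - Real.pi ≤ ω * c → AntitoneOn v (Icc c t₁) := by
    intro c hc hc'
    refine antitoneOn_of_deriv_nonpos (convex_Icc _ _) h.continuous.continuousOn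
      (fun s _ => (h.hasDerivAt s).differentiableAt.differentiableWithinAt) fun s hs' => ?_
    rw [interior_Icc] at hs'
    rw [(h.hasDerivAt s).deriv, hv s (hc.trans hs'.1.le)]
    refine mul_nonpos_of_nonneg_of_nonpos (by positivity)
      (Real.sin_nonpos_of_nonpos_of_neg_pi_le ?_ ?_)
    · rw [← hωt₁]; nlinarith [hs'.2]
    · nlinarith [hs'.1]
  have hmin : ∀ t ∈ Icc 0 t₁, min (v 0) (v t₁) ≤ v t := by
    intro t ht
    rcases le_total θ Real.pi with hθπ | hθπ
    · exact min_le_of_right_le (hanti 0 le_rfl (by linarith) ht (right_mem_Icc.2 ht₁0.le) ht.2)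
    -- The velocity is first positive, until `ω t = θ - π`, then negative.
    rcases le_total (ω * t) (θ - Real.pi) with htθ | htθ
    · refine min_le_of_left_le ?_
      have hmono : MonotoneOn v (Icc 0 t) := by
        refine monotoneOn_of_deriv_nonneg (convex_Icc _ _) h.continuous.continuousOn
          (fun s _ => (h.hasDerivAt s).differentiableAt.differentiableWithinAt) fun s hs' => ?_
        rw [interior_Icc] at hs'
        rw [(h.hasDerivAt s).deriv, hv s hs'.1.le]
        refine mul_nonneg (by positivity) ?_
        rw [← Real.sin_add_two_pi]
        have h1 : 0 < ω * s := mul_pos hω hs'.1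
        have h2 : ω * s ≤ ω * t := mul_le_mul_of_nonneg_left hs'.2.le hω.le
        have h3 := hθ.2
        rw [← Real.sin_pi_sub]
        exact Real.sin_nonneg_of_nonneg_of_le_pi (by linarith) (by linarith)
      exact hmono (left_mem_Icc.2 ht.1) (right_mem_Icc.2 ht.1) ht.1
    · exact min_le_of_right_le
        (hanti t ht.1 htθ (left_mem_Icc.2 ht.2) (right_mem_Icc.2 ht.2) ht.2)
  rw [h.exists_le_iff_of_first_min hM (by linarith) ht₁0 hv't₁ hvt₁.le hmin]
  have hQ := h.quadratic_form_eq t₁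
  rw [hv't₁, hv0, hv0'] at hQ
  have hE := Real.exp_pos t₁
  have hME : 0 < (ω ^ 2 + 1 / 4) * Real.exp t₁ := by positivity
  have hrw : (d + (1 - b) / 2) ^ 2 + ω ^ 2 * (1 - b) ^ 2
      = (ω ^ 2 + 1 / 4) * Real.exp t₁ * v t₁ ^ 2 := by linear_combination -hQ
  rw [hrw, show (ω ^ 2 + 1 / 4) * b ^ 2 * Real.exp t₁
    = (ω ^ 2 + 1 / 4) * Real.exp t₁ * b ^ 2 by ring, mul_le_mul_iff_right₀ hME]
  constructor <;> intro hh
  · nlinarith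
  · have := abs_le_of_sq_le_sq (show b ^ 2 ≤ (-v t₁) ^ 2 by linarith) (by linarith)
    linarith [le_abs_self b]

end IsDampedOscillator

/-- The angle `θ = angle M r d` is the phase of the velocity: the branches of the arctangent are
such that `ω t = θ` at the first minimum. The pair `(d, d + 2M - 4r)` vanishes exactly when the
oscillator is at rest. -/
theorem angle_spec {M r d ω : ℝ} (hω : 0 < ω) (hωM : √(M - 1 / 4) = ω)
    (h0 : ¬ (d = 0 ∧ d + 2 * M - 4 * r = 0)) :
    ∃ κ > 0, angle M r d ∈ Ioc 0 (2 * Real.pi) ∧ d = -κ * Real.sin (angle M r d) ∧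
      (d + 2 * M - 4 * r) / (2 * ω) = -κ * Real.cos (angle M r d) := by
  have hpi := Real.pi_pos
  unfold angle betaShift
  rw [hωM]
  set e := d + 2 * M - 4 * r with he
  by_cases he0 : e = 0
  · rw [if_pos he0, he0]
    by_cases hd : d < 0
    · rw [if_pos hd]
      exact ⟨-d, by linarith, ⟨by linarith, by linarith⟩, by simp, by simp⟩
    · rw [if_neg hd]
      have hd' : d ≠ 0 := fun h => h0 ⟨h, he0⟩
      have h32 : 3 * Real.pi / 2 = Real.pi / 2 + Real.pi := by ring
      refine ⟨d, lt_of_le_of_ne (not_lt.1 hd) hd'.symm, ⟨by linarith, by linarith⟩, ?_, ?_⟩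
      · rw [h32, Real.sin_add_pi]; simp
      · rw [h32, Real.cos_add_pi]; simp
  rw [if_neg he0]
  set x := 2 * d * ω / e with hx
  have hdx : d = e / (2 * ω) * x := by rw [hx]; field_simp
  set N := √(1 + x ^ 2) with hN
  have hN0 : 0 < N := Real.sqrt_pos.2 (by positivity)
  have hsin : Real.sin (Real.arctan x) = x / N := Real.sin_arctan x
  have hcos : Real.cos (Real.arctan x) = 1 / N := Real.cos_arctan x
  have hlt := Real.arctan_lt_pi_div_two x
  have hgt := Real.neg_pi_div_two_lt_arctan x
  have hcond1 : d < min 0 (4 * (r - M / 2)) ↔ d < 0 ∧ e < 0 := by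
    rw [lt_min_iff, he]
    constructor <;> rintro ⟨h1, h2⟩ <;> exact ⟨h1, by linarith⟩
  have hcond2 : 4 * (r - M / 2) < d ↔ 0 < e := by
    rw [he]
    constructor <;> intro h <;> linarith
  rw [if_congr hcond1 rfl (if_congr hcond2 rfl rfl)]
  rcases lt_or_gt_of_ne he0 with hneg | hpos
  · have hf : e / (2 * ω) < 0 := div_neg_of_neg_of_pos hneg (by positivity)
    refine ⟨-(e / (2 * ω)) * N, mul_pos (by linarith) hN0, ?_⟩
    by_cases hd : d < 0
    · rw [if_pos ⟨hd, hneg⟩, zero_add, hsin, hcos]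
      have hx0 : 0 < x := div_pos_of_neg_of_neg (by nlinarith) hneg
      refine ⟨⟨Real.arctan_pos.2 hx0, by linarith⟩, ?_, ?_⟩
      · field_simp
        rw [hx]
        field_simp
      · field_simp
    · rw [if_neg (fun h => hd h.1), if_neg (not_lt.2 hneg.le), add_comm, Real.sin_add_two_pi,
        Real.cos_add_two_pi, hsin, hcos]
      have hx0 : x ≤ 0 := div_nonpos_of_nonneg_of_nonpos
        (mul_nonneg (by linarith) hω.le) hneg.le
      have := Real.arctan_le_zero.2 hx0
      refine ⟨⟨by linarith, by linarith⟩, ?_, ?_⟩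
      · field_simp
        rw [hx]
        field_simp
      · field_simp
  · have hf : 0 < e / (2 * ω) := div_pos hpos (by positivity)
    refine ⟨e / (2 * ω) * N, mul_pos hf hN0, ?_⟩
    rw [if_neg (fun h => hpos.not_gt h.2), if_pos hpos, add_comm, Real.sin_add_pi,
      Real.cos_add_pi, hsin, hcos]
    refine ⟨⟨by linarith, by linarith⟩, ?_, ?_⟩
    · field_simp
      rw [hx]
      field_simp
    · field_simp

/-- The explicit inequalities say that the oscillator with initial position `1 - 2r/M` and initial
velocity `d` reaches the level `-2r/M` in positive time. -/
theorem IsDampedOscillator.exists_le_iff_breakdownIneq {M r d : ℝ} {v v' : ℝ → ℝ}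
    (h : IsDampedOscillator M v v') (hM : 0 < M) (hr : 0 < r) (hv0 : v 0 = 1 - 2 * r / M)
    (hv0' : v' 0 = d) : (∃ t > 0, 2 * r / M + v t ≤ 0) ↔ BreakdownIneq M r d := by
  obtain ⟨b, hb⟩ : ∃ b, b = 2 * r / M := ⟨_, rfl⟩
  have hb0 : 0 < b := by rw [hb]; positivity
  have hrb : r = M * b / 2 := by rw [hb]; field_simp
  rw [← hb] at hv0 ⊢
  unfold BreakdownIneq
  rcases lt_trichotomy M (1 / 4) with hlt | heq | hgt
  · simp only [hlt, hlt.ne, hlt.not_gt, true_and, false_and, or_false]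
    set s := √(1 - 4 * M) with hs
    have hs0 : 0 < s := Real.sqrt_pos.2 (by linarith)
    have hs2 : s ^ 2 = 1 - 4 * M := Real.sq_sqrt (by linarith)
    have hs1 : s < 1 := by nlinarith
    obtain ⟨p, hp⟩ : ∃ p, p = (1 - s) / 2 := ⟨_, rfl⟩
    obtain ⟨q, hq⟩ : ∃ q, q = (1 + s) / 2 := ⟨_, rfl⟩
    have hp0 : 0 < p := by rw [hp]; linarith
    have hq0 : 0 < q := by rw [hq]; linarith
    have hpq : p < q := by linarith
    have hMpq : M = p * q := by rw [hp, hq]; linear_combination hs2 / 4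
    have hl₁ : lam₁ M = 2 / q := by
      rw [lam₁, ← hs, div_eq_div_iff hM.ne' hq0.ne', hMpq, hp]; ring
    have hl₂ : lam₂ M = 2 / p := by
      rw [lam₂, ← hs, div_eq_div_iff hM.ne' hp0.ne', hMpq, hq]; ring
    rw [hMpq] at h
    rw [h.exists_le_iff_overdamped hp0 hpq (by linarith) hb0 hv0 hv0', SubcriticalIneq, hl₁, hl₂,
      max_lt_iff, and_assoc]
    have h1 : 2 / p * (M / 2 - r) = q * (1 - b) := by rw [hrb, hMpq]; field_simp
    have h2 : (M / 2 * (2 / p) * d + M - 2 * r) / (2 * r) = (d + p * (1 - b)) / (p * b) := by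
      rw [hrb, hMpq]; field_simp; ring
    have h3 : (M / 2 * (2 / q) * d + M - 2 * r) / (2 * r) = (d + q * (1 - b)) / (q * b) := by
      rw [hrb, hMpq]; field_simp; ring
    rw [h1, h2, h3]
    refine and_congr_right fun hd => and_congr_right fun hd2 => ?_
    have hd1 : d + p * (1 - b) < 0 := by
      rcases le_total b 1 with hb1 | hb1
      · linarith [mul_le_mul_of_nonneg_right hpq.le (sub_nonneg.2 hb1)]
      · linarith [mul_nonpos_of_nonneg_of_nonpos hp0.le (sub_nonpos.2 hb1)]
    have hx0 : 0 < -(d + p * (1 - b)) / (p * b) := div_pos (by linarith) (by positivity)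
    have hy0 : 0 < -(d + q * (1 - b)) / (q * b) := div_pos (by linarith) (by positivity)
    rw [← abs_neg, ← neg_div, abs_of_pos hx0, ← abs_neg ((d + q * (1 - b)) / (q * b)), ← neg_div,
      abs_of_pos hy0, Real.rpow_def_of_pos hx0, Real.rpow_def_of_pos hy0, Real.exp_le_exp]
    generalize Real.log (-(d + p * (1 - b)) / (p * b)) = lx
    generalize Real.log (-(d + q * (1 - b)) / (q * b)) = ly
    rw [mul_div_assoc', mul_div_assoc', div_le_div_iff₀ hq0 hp0]
    constructor <;> intro hh <;> linarith
  · simp only [heq, lt_irrefl, false_and, true_and, false_or, or_false]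
    rw [heq] at h hrb
    rw [h.exists_le_iff_critical hb0 hv0 hv0', CriticalIneq, max_lt_iff, and_assoc]
    have h1 : 1 / 4 * d + 1 / 4 / 2 - r = (d + (1 - b) / 2) / 4 := by rw [hrb]; ring
    rw [h1]
    refine and_congr_right fun hd => and_congr ?_ ?_
    · constructor <;> intro hh <;> linarith
    · have h2 : 1 / 4 * d / ((d + (1 - b) / 2) / 4) = d / (d + (1 - b) / 2) := by
        rw [one_div_mul_eq_div, div_div_div_cancel_right₀ (by norm_num)]
      have h3 : -((d + (1 - b) / 2) / 4 / r) = -(d + (1 - b) / 2) * 2 / b := by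
        rw [hrb]; field_simp
      rw [h2, h3]
  · simp only [hgt, hgt.ne', hgt.not_gt, true_and, false_and, false_or]
    set ω := √(M - 1 / 4) with hωdef
    have hω : 0 < ω := Real.sqrt_pos.2 (by linarith)
    have hω2 : ω ^ 2 = M - 1 / 4 := Real.sq_sqrt (by linarith)
    have hMω : M = ω ^ 2 + 1 / 4 := by linarith
    have hineq : SupercriticalIneq M r d ↔ M * b ^ 2 * Real.exp (1 / ω * angle M r d)
        ≤ (d + (1 - b) / 2) ^ 2 + ω ^ 2 * (1 - b) ^ 2 := by
      have h1 : d + (M / 2 - r) / M = d + (1 - b) / 2 := by rw [hrb]; field_simp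
      have h2 : ω ^ 2 * (4 * r ^ 2 / M ^ 2 * (M * Real.exp (1 / ω * angle M r d) / ω ^ 2 - 1)
          + (4 * r - M) / M) = M * b ^ 2 * Real.exp (1 / ω * angle M r d)
            - ω ^ 2 * (1 - b) ^ 2 := by
        rw [show 4 * r ^ 2 / M ^ 2 = b ^ 2 by rw [hrb]; field_simp; ring,
          show (4 * r - M) / M = 2 * b - 1 by rw [hrb]; field_simp; ring]
        field_simp
        ring
      rw [SupercriticalIneq, tStar, ← hωdef, ← hω2, h1, h2, sub_le_iff_le_add]
    have he : d + 2 * M - 4 * r = d + 2 * M * (1 - b) := by rw [hrb]; ring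
    rw [hineq]
    by_cases h0 : d = 0 ∧ d + 2 * M - 4 * r = 0
    · -- The oscillator is at rest.
      have hb1 : 1 - b = 0 := by
        have : 2 * M * (1 - b) = 0 := by linarith [h0.1, h0.2]
        rcases mul_eq_zero.1 this with h1 | h1
        · linarith
        · exact h1
      have hrest : IsDampedOscillator M (fun _ => 0) (fun _ => 0) :=
        ⟨fun t => hasDerivAt_const t 0, fun t => by simpa using hasDerivAt_const t (0 : ℝ)⟩
      refine iff_of_false ?_ ?_
      · rintro ⟨t, ht, hbt⟩
        rw [(h.eq_of_initial hrest (by simp [hv0, hb1]) (by simp [hv0', h0.1]) ht.le).1] at hbt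
        linarith
      · rw [hb1, h0.1]
        have : 0 < M * b ^ 2 * Real.exp (1 / ω * angle M r 0) := by positivity
        simpa using this
    · obtain ⟨κ, hκ, hθ, hs, hc⟩ := angle_spec hω rfl h0
      rw [he] at hc
      have h' : IsDampedOscillator (ω ^ 2 + 1 / 4) v v' := hMω ▸ h
      rw [h'.exists_le_iff_underdamped hω hb0 hv0 hv0' hκ hθ hs (by rw [← hMω]; exact hc), ← hMω]

/-! ### Uniform positivity by compactness -/

/-- A limit value of the pair `(r, d)` is attained, unless its first component vanishes. -/
theorem mem_range_of_mem_closure_range {r d : ℝ → ℝ} (hr : Continuous r) (hd : Continuous d)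
    (hr0 : Tendsto r (cocompact ℝ) (𝓝 0)) {p : ℝ × ℝ}
    (hp : p ∈ closure (range fun x => (r x, d x))) (hp0 : 0 < p.1) :
    p ∈ range fun x => (r x, d x) := by
  set A := {x | p.1 / 2 ≤ r x} with hA
  have hAc : IsCompact A := by
    have h1 : ∀ᶠ x in cocompact ℝ, r x < p.1 / 2 := hr0.eventually_lt_const (by linarith)
    obtain ⟨B, hB, hBA⟩ := mem_cocompact.1 h1
    refine hB.of_isClosed_subset (isClosed_le continuous_const hr) fun x hx => ?_
    by_contra hxB
    have : r x < p.1 / 2 := hBA hxB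
    exact absurd hx (not_le.2 this)
  have himg : IsClosed ((fun x => (r x, d x)) '' A) :=
    (hAc.image (hr.prodMk hd)).isClosed
  have hU : IsOpen {q : ℝ × ℝ | p.1 / 2 < q.1} := isOpen_lt continuous_const continuous_fst
  have hsub : {q : ℝ × ℝ | p.1 / 2 < q.1} ∩ range (fun x => (r x, d x))
      ⊆ (fun x => (r x, d x)) '' A := by
    rintro q ⟨hq, x, rfl⟩
    have hq' : p.1 / 2 < r x := hq
    exact ⟨x, hq'.le, rfl⟩
  have h := closure_minimal hsub himg (hU.inter_closure
    ⟨show p.1 / 2 < p.1 by linarith, hp⟩)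
  exact image_subset_range _ _ h

/-- If `φ₁ + d φ₂ + 2 r φ₃` is positive on `[0, S)` for all `(r, d) = (r x, d x)`, then it is bounded
below on `[0, S']`, `S' < S`, uniformly in `x`. By compactness only limit values of `(r, d)` matter;
those with `r = 0` could only produce a double zero of the solution `φ₁ + d φ₂` of a homogeneous
equation, which the Wronskian excludes. -/
theorem exists_pos_lower_bound {S S' C : ℝ} (hS' : S' < S) {r d φ₁ φ₂ φ₃ φ₁' φ₂' : ℝ → ℝ}
    (hr : Continuous r) (hd : Continuous d) (hrpos : ∀ x, 0 < r x)
    (hr0 : Tendsto r (cocompact ℝ) (𝓝 0)) (hdC : ∀ x, |d x| ≤ C)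
    (hc₁ : ContinuousOn φ₁ (Icc 0 S)) (hc₂ : ContinuousOn φ₂ (Icc 0 S))
    (hc₃ : ContinuousOn φ₃ (Icc 0 S))
    (hd₁ : ∀ t ∈ Ioo 0 S, HasDerivAt φ₁ (φ₁' t) t) (hd₂ : ∀ t ∈ Ioo 0 S, HasDerivAt φ₂ (φ₂' t) t)
    (hW : ∀ t ∈ Ioo 0 S, φ₁ t * φ₂' t - φ₁' t * φ₂ t ≠ 0) (h₁ : φ₁ 0 = 1) (h₂ : φ₂ 0 = 0)
    (hpos : ∀ x, ∀ t ∈ Ico 0 S, 0 < φ₁ t + d x * φ₂ t + 2 * r x * φ₃ t) :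
    ∃ c > 0, ∀ x, ∀ t ∈ Icc 0 S', c ≤ φ₁ t + d x * φ₂ t + 2 * r x * φ₃ t := by
  rcases lt_or_ge S' 0 with hneg | hS'0
  · exact ⟨1, one_pos, fun x t ht => absurd (ht.1.trans ht.2) (not_le.2 hneg)⟩
  set K := closure (range fun x => (r x, d x)) with hK
  obtain ⟨R, hR⟩ : ∃ R, ∀ x, |r x| ≤ R := by
    obtain ⟨B, hB, hB1⟩ := mem_cocompact.1 (hr0.eventually_lt_const one_pos)
    obtain ⟨R, hR⟩ := hB.exists_bound_of_continuousOn hr.continuousOn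
    refine ⟨max 1 R, fun x => ?_⟩
    by_cases hx : x ∈ B
    · exact (hR x hx).trans (le_max_right _ _)
    · have h1 : r x < 1 := hB1 hx
      rw [abs_of_pos (hrpos x)]
      exact h1.le.trans (le_max_left _ _)
  have hKc : IsCompact K := by
    refine Metric.isCompact_of_isClosed_isBounded isClosed_closure (Bornology.IsBounded.closure ?_)
    refine (isBounded_iff_forall_norm_le.2 ⟨max R C, ?_⟩)
    rintro _ ⟨x, rfl⟩
    exact max_le_max (hR x) (hdC x)
  have hsub : Icc 0 S' ⊆ Ico 0 S := fun t ht => ⟨ht.1, ht.2.trans_lt hS'⟩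
  have hsub' : Icc 0 S' ⊆ Icc 0 S := hsub.trans Ico_subset_Icc_self
  set g : (ℝ × ℝ) × ℝ → ℝ := fun p => φ₁ p.2 + p.1.2 * φ₂ p.2 + 2 * p.1.1 * φ₃ p.2 with hg
  have hmaps : MapsTo (Prod.snd : (ℝ × ℝ) × ℝ → ℝ) (K ×ˢ Icc 0 S') (Icc 0 S) :=
    fun p hp => hsub' hp.2
  have hgc : ContinuousOn g (K ×ˢ Icc 0 S') := by
    have k₁ := hc₁.comp continuousOn_snd hmaps
    have k₂ := hc₂.comp continuousOn_snd hmaps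
    have k₃ := hc₃.comp continuousOn_snd hmaps
    simp only [Function.comp_def] at k₁ k₂ k₃
    fun_prop
  have hne : (K ×ˢ Icc 0 S').Nonempty :=
    ⟨((r 0, d 0), 0), subset_closure ⟨0, rfl⟩, left_mem_Icc.2 hS'0⟩
  obtain ⟨⟨q, t⟩, ⟨hq, ht⟩, hmin⟩ := (hKc.prod isCompact_Icc).exists_isMinOn hne hgc
  have hle : ∀ x, ∀ t' ∈ Icc 0 S', g (q, t) ≤ φ₁ t' + d x * φ₂ t' + 2 * r x * φ₃ t' :=
    fun x t' ht' => hmin (show ((r x, d x), t') ∈ K ×ˢ Icc 0 S' from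
      ⟨subset_closure ⟨x, rfl⟩, ht'⟩)
  rcases lt_or_ge 0 (g (q, t)) with h0 | h0
  · exact ⟨_, h0, hle⟩
  exfalso
  have hq0 : 0 ≤ q.1 := by
    have : K ⊆ {p : ℝ × ℝ | 0 ≤ p.1} := closure_minimal
      (by rintro _ ⟨x, rfl⟩; exact (hrpos x).le) (isClosed_le continuous_const continuous_fst)
    exact this hq
  rcases hq0.eq_or_lt with hq0 | hq0
  swap
  · obtain ⟨x, rfl⟩ := mem_range_of_mem_closure_range hr hd hr0 hq hq0
    exact absurd (hpos x t (hsub ht)) (not_lt.2 h0)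
  have hnn : ∀ s ∈ Ico 0 S, 0 ≤ φ₁ s + q.2 * φ₂ s := by
    intro s hs
    have : K ⊆ {p : ℝ × ℝ | 0 ≤ φ₁ s + p.2 * φ₂ s + 2 * p.1 * φ₃ s} := closure_minimal
      (by rintro _ ⟨x, rfl⟩; exact (hpos x s hs).le)
      (isClosed_le continuous_const (by fun_prop))
    have h1 : 0 ≤ φ₁ s + q.2 * φ₂ s + 2 * q.1 * φ₃ s := this hq
    rwa [← hq0, mul_zero, zero_mul, add_zero] at h1
  have hzero : φ₁ t + q.2 * φ₂ t = 0 := by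
    refine le_antisymm ?_ (hnn t (hsub ht))
    simp only [hg] at h0
    rwa [← hq0, mul_zero, zero_mul, add_zero] at h0
  have ht0 : t ≠ 0 := by
    rintro rfl
    rw [h₁, h₂] at hzero
    norm_num at hzero
  have htI : t ∈ Ioo 0 S := ⟨lt_of_le_of_ne ht.1 ht0.symm, (hsub ht).2⟩
  have hloc : IsLocalMin (fun s => φ₁ s + q.2 * φ₂ s) t := by
    filter_upwards [Ioo_mem_nhds htI.1 htI.2] with s hs
    rw [hzero]
    exact hnn s (Ioo_subset_Ico_self hs)
  have hder := hloc.hasDerivAt_eq_zero ((hd₁ t htI).add ((hd₂ t htI).const_mul q.2))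
  refine hW t htI ?_
  linear_combination φ₂' t * hzero - φ₂ t * hder

/-! ### Integrals of decaying densities -/

/-- The force field of a density with finite first moment, through its cumulative mass. -/
theorem integral_deriv_W_mul {g : ℝ → ℝ} (hg : Integrable g) (hyg : Integrable fun y => y * g y)
    (x : ℝ) : ∫ y, deriv W (x - y) * g y
      = -2 * (∫ y in Iic x, g y) + (1 + x) * (∫ y, g y) - ∫ y, y * g y := by
  have hae : (fun y => deriv W (x - y) * g y) =ᵐ[volume]
      fun y => (1 + x) * g y - y * g y + -2 * (Iic x).indicator g y := by
    filter_upwards [compl_mem_ae_iff.2 (measure_singleton x)] with y hy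
    have hxy : x - y ≠ 0 := sub_ne_zero.2 (Ne.symm hy)
    rw [(hasDerivAt_W hxy).deriv]
    rcases lt_or_gt_of_ne hy with h | h
    · rw [Real.sign_of_pos (sub_pos.2 h), indicator_of_mem (mem_Iic.2 h.le)]
      ring
    · rw [Real.sign_of_neg (sub_neg.2 h), indicator_of_notMem (by simpa using h)]
      ring
  have hint : Integrable fun y => (1 + x) * g y - y * g y := (hg.const_mul _).sub hyg
  rw [integral_congr_ae hae, integral_add hint
    ((hg.indicator measurableSet_Iic).const_mul _), integral_sub (hg.const_mul _) hyg,
    integral_const_mul, integral_const_mul, integral_indicator measurableSet_Iic]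
  ring

theorem one_add_abs_rpow_pos (s x : ℝ) : 0 < (1 + |x|) ^ s :=
  Real.rpow_pos_of_pos (by positivity) s

theorem integrable_of_decay {δ C : ℝ} (hδ : 0 < δ) {g : ℝ → ℝ} (hg : Continuous g)
    (hC : ∀ x, |g x| ≤ C * (1 + |x|) ^ (-(2 + δ))) : Integrable g := by
  have h := (integrable_one_add_norm (E := ℝ) (μ := volume) (r := 2 + δ)
    (by simp; linarith)).const_mul C
  exact h.mono' hg.aestronglyMeasurable (Eventually.of_forall fun x => by simpa using hC x)

theorem abs_mul_decay_le {δ C : ℝ} {x y : ℝ} (hC : |y| ≤ C * (1 + |x|) ^ (-(2 + δ))) {A z : ℝ}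
    (hz : |z| ≤ A * (1 + |x|)) : |z * y| ≤ A * C * (1 + |x|) ^ (-(1 + δ)) := by
  have h1 : (1 + |x|) ^ (-(1 + δ)) = (1 + |x|) * (1 + |x|) ^ (-(2 + δ)) := by
    rw [show -(1 + δ) = 1 + -(2 + δ) by ring, Real.rpow_add (by positivity), Real.rpow_one]
  rw [abs_mul, h1]
  calc |z| * |y| ≤ (A * (1 + |x|)) * (C * (1 + |x|) ^ (-(2 + δ))) :=
        mul_le_mul hz hC (abs_nonneg _) ((abs_nonneg _).trans hz)
    _ = _ := by ring

theorem integrable_mul_of_decay {δ C A : ℝ} (hδ : 0 < δ) {g k : ℝ → ℝ} (hg : Continuous g)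
    (hk : Continuous k) (hC : ∀ x, |g x| ≤ C * (1 + |x|) ^ (-(2 + δ)))
    (hA : ∀ x, |k x| ≤ A * (1 + |x|)) : Integrable fun x => k x * g x := by
  have h := (integrable_one_add_norm (E := ℝ) (μ := volume) (r := 1 + δ)
    (by simp; linarith)).const_mul (A * C)
  exact h.mono' (hk.mul hg).aestronglyMeasurable
    (Eventually.of_forall fun x => abs_mul_decay_le (hC x) (hA x))

/-- A bound at infinity by `|x|^{-(2+δ)}` and a bound on `[-1, 1]` combine to an integrable
majorant. -/
theorem abs_le_of_decay {δ C x y : ℝ} (hδ : 0 < δ) (h : |x| ^ (2 + δ) * |y| ≤ C)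
    (h1 : |x| ≤ 1 → |y| ≤ C) : |y| ≤ 2 ^ (2 + δ) * C * (1 + |x|) ^ (-(2 + δ)) := by
  have hpos := one_add_abs_rpow_pos (2 + δ) x
  rw [Real.rpow_neg (by positivity), ← div_eq_mul_inv, le_div_iff₀ hpos]
  rcases le_total |x| 1 with hx | hx
  · have h2 : (1 + |x|) ^ (2 + δ) ≤ 2 ^ (2 + δ) :=
      Real.rpow_le_rpow (by positivity) (by linarith) (by linarith)
    have h3 := mul_le_mul (h1 hx) h2 hpos.le ((abs_nonneg _).trans (h1 hx))
    linarith
  · have h2 : (1 + |x|) ^ (2 + δ) ≤ 2 ^ (2 + δ) * |x| ^ (2 + δ) := by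
      rw [← Real.mul_rpow (by norm_num) (abs_nonneg x)]
      exact Real.rpow_le_rpow (by positivity) (by linarith) (by linarith)
    have h3 := mul_le_mul_of_nonneg_left h2 (abs_nonneg y)
    have h4 : (0 : ℝ) < 2 ^ (2 + δ) := by positivity
    nlinarith [mul_le_mul_of_nonneg_left h h4.le]

theorem tendsto_one_add_abs_rpow_neg {s : ℝ} (hs : 0 < s) :
    Tendsto (fun x : ℝ => (1 + |x|) ^ (-s)) (cocompact ℝ) (𝓝 0) :=
  (tendsto_rpow_neg_atTop hs).comp
    (tendsto_atTop_add_const_left _ 1 (tendsto_norm_cocompact_atTop (E := ℝ)))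

/-! ### Increasing changes of variables -/

theorem monotone_sub_mul_of_deriv_ge {f f' : ℝ → ℝ} {c : ℝ} (hf : ∀ x, HasDerivAt f (f' x) x)
    (hf' : ∀ x, c ≤ f' x) : Monotone fun x => f x - c * x := by
  have hd : ∀ x, HasDerivAt (fun x => f x - c * x) (f' x - c) x := fun x =>
    ((hf x).sub ((hasDerivAt_id x).const_mul c)).congr_deriv (by ring)
  refine monotone_of_deriv_nonneg (fun x => (hd x).differentiableAt) fun x => ?_
  rw [(hd x).deriv]
  linarith [hf' x]

theorem mul_abs_le_of_deriv_ge {f f' : ℝ → ℝ} {c : ℝ} (hf : ∀ x, HasDerivAt f (f' x) x)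
    (hf' : ∀ x, c ≤ f' x) (x : ℝ) : c * |x| ≤ |f x| + |f 0| := by
  have hmono := monotone_sub_mul_of_deriv_ge hf hf'
  rcases le_total 0 x with hx | hx
  · have := hmono hx
    simp only [mul_zero, sub_zero] at this
    rw [abs_of_nonneg hx]
    linarith [le_abs_self (f x), neg_abs_le (f 0)]
  · have := hmono hx
    simp only [mul_zero, sub_zero] at this
    rw [abs_of_nonpos hx]
    linarith [neg_abs_le (f x), le_abs_self (f 0)]

theorem strictMono_and_surjective_of_deriv_ge {f f' : ℝ → ℝ} {c : ℝ} (hc : 0 < c)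
    (hf : ∀ x, HasDerivAt f (f' x) x) (hf' : ∀ x, c ≤ f' x) :
    StrictMono f ∧ Function.Surjective f := by
  refine ⟨strictMono_of_deriv_pos fun x => by rw [(hf x).deriv]; exact hc.trans_le (hf' x), ?_⟩
  have hmono := monotone_sub_mul_of_deriv_ge hf hf'
  have hcont : Continuous f := continuous_iff_continuousAt.2 fun x => (hf x).continuousAt
  refine hcont.surjective ?_ ?_
  · refine tendsto_atTop_mono' _ ?_ (tendsto_atTop_add_const_left _ (f 0)
      (tendsto_id.const_mul_atTop hc))
    filter_upwards [eventually_ge_atTop 0] with x hx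
    have := hmono hx
    simp only [mul_zero, sub_zero, id] at this ⊢
    linarith
  · refine tendsto_atBot_mono' _ ?_ (tendsto_atBot_add_const_left _ (f 0)
      (tendsto_id.const_mul_atBot hc))
    filter_upwards [eventually_le_atBot 0] with x hx
    have := hmono hx
    simp only [mul_zero, sub_zero, id] at this ⊢
    linarith

theorem setIntegral_image_of_strictMono {f f' g h : ℝ → ℝ} (hf : ∀ x, HasDerivAt f (f' x) x)
    (hf' : ∀ x, 0 < f' x) (hmono : StrictMono f) (hgh : ∀ x, h x = g (f x) * f' x) {s : Set ℝ}
    (hs : MeasurableSet s) : ∫ y in f '' s, g y = ∫ x in s, h x := by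
  rw [integral_image_eq_integral_abs_deriv_smul hs (fun x _ => (hf x).hasDerivWithinAt)
    hmono.injective.injOn]
  refine setIntegral_congr_fun hs fun x _ => ?_
  simp only [smul_eq_mul, abs_of_pos (hf' x), hgh x, mul_comm]

/-! ### A priori analysis of solutions -/

/-- The Jacobian of the flow map at a point where the density is `r` and the slope of the velocity
is `d`, in terms of the fundamental solution `φ` of the oscillator (`φ 0 = 0`, `φ' 0 = 1`); it solves
`w'' + w' + M w = 2 r`, `w 0 = 1`, `w' 0 = d`. -/
def stretch (M : ℝ) (φ φ' : ℝ → ℝ) (r d t : ℝ) : ℝ :=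
  2 * r / M + ((1 - 2 * r / M) * (φ t + φ' t) + d * φ t)

theorem IsDampedOscillator.exists_stretch_nonpos_iff {M r d : ℝ} {φ φ' : ℝ → ℝ}
    (h : IsDampedOscillator M φ φ') (h0 : φ 0 = 0) (h0' : φ' 0 = 1) (hM : 0 < M) (hr : 0 < r) :
    (∃ t > 0, stretch M φ φ' r d t ≤ 0) ↔ BreakdownIneq M r d := by
  have := ((h.linear_combination h.deriv_self 1 1).linear_combination h (1 - 2 * r / M)
    d).exists_le_iff_breakdownIneq (d := d) hM hr (by simp [h0, h0']) (by simp [h0, h0'])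
  simpa only [stretch, one_mul] using this

section Slices

variable {f : ℝ → ℝ → ℝ} {L : ℝ × ℝ →L[ℝ] ℝ} {x t : ℝ}

theorem hasDerivAt_space_slice (hf : HasFDerivAt (fun p : ℝ × ℝ => f p.1 p.2) L (x, t)) :
    HasDerivAt (fun y => f y t) (L (1, 0)) x :=
  HasFDerivAt.comp_hasDerivAt (f := fun y => (y, t)) x hf
    ((hasDerivAt_id x).prodMk (hasDerivAt_const x t))

theorem hasDerivAt_time_slice (hf : HasFDerivAt (fun p : ℝ × ℝ => f p.1 p.2) L (x, t)) :
    HasDerivAt (fun s => f x s) (L (0, 1)) t :=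
  HasFDerivAt.comp_hasDerivAt (f := fun s => (x, s)) t hf
    ((hasDerivAt_const t x).prodMk (hasDerivAt_id t))

theorem hasDerivAt_along_curve {X : ℝ → ℝ} {v : ℝ}
    (hf : HasFDerivAt (fun p : ℝ × ℝ => f p.1 p.2) L (X t, t)) (hX : HasDerivAt X v t) :
    HasDerivAt (fun s => f (X s) s) (L (v, 1)) t :=
  HasFDerivAt.comp_hasDerivAt (f := fun s => (X s, s)) t hf (hX.prodMk (hasDerivAt_id t))

end Slices

section FarField

variable {δ T : ℝ} {ρ u : ℝ → ℝ → ℝ}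

theorem continuous_space_slice {f : ℝ → ℝ → ℝ}
    (hf : ContinuousOn (fun p : ℝ × ℝ => f p.1 p.2) (univ ×ˢ Ico 0 T)) {t : ℝ}
    (ht : t ∈ Ico 0 T) : Continuous fun x => f x t := by
  rw [← continuousOn_univ]
  exact hf.comp (f := fun x : ℝ => (x, t)) (by fun_prop) fun x _ => ⟨mem_univ _, ht⟩

theorem continuousOn_time_slice {f : ℝ → ℝ → ℝ}
    (hf : ContinuousOn (fun p : ℝ × ℝ => f p.1 p.2) (univ ×ˢ Ico 0 T)) (x : ℝ) :
    ContinuousOn (fun t => f x t) (Ico 0 T) :=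
  hf.comp (f := fun t : ℝ => (x, t)) (by fun_prop) fun t ht => ⟨mem_univ _, ht⟩

theorem FarField.exists_density_bound (hδ : 0 < δ)
    (hρ : ContinuousOn (fun p : ℝ × ℝ => ρ p.1 p.2) (univ ×ˢ Ico 0 T)) (h : FarField δ T ρ u)
    {S : ℝ} (hS : S ∈ Ico 0 T) :
    ∃ C, ∀ t ∈ Icc 0 S, ∀ x, |ρ x t| ≤ C * (1 + |x|) ^ (-(2 + δ)) := by
  obtain ⟨C, hC⟩ := h.density_decay S hS
  have hsub : Icc (-1 : ℝ) 1 ×ˢ Icc 0 S ⊆ univ ×ˢ Ico 0 T :=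
    fun p hp => ⟨mem_univ _, hp.2.1, hp.2.2.trans_lt hS.2⟩
  obtain ⟨B, hB⟩ := (isCompact_Icc.prod isCompact_Icc).exists_bound_of_continuousOn (hρ.mono hsub)
  exact ⟨_, fun t ht x => abs_le_of_decay (C := max C B) hδ ((hC t ht x).trans (le_max_left _ _))
    fun hx => (hB (x, t) ⟨abs_le.1 hx, ht⟩).trans (le_max_right _ _)⟩

theorem continuousOn_setIntegral_density (hδ : 0 < δ) {S C : ℝ} (hS : S < T)
    (hρ : ContinuousOn (fun p : ℝ × ℝ => ρ p.1 p.2) (univ ×ˢ Ico 0 T))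
    (hC : ∀ t ∈ Icc 0 S, ∀ x, |ρ x t| ≤ C * (1 + |x|) ^ (-(2 + δ))) {k : ℝ → ℝ}
    (hk : Continuous k) (hk1 : ∀ x, |k x| ≤ 1 * (1 + |x|)) (s : Set ℝ) :
    ContinuousOn (fun t => ∫ y in s, k y * ρ y t) (Icc 0 S) := by
  have hsub : Icc 0 S ⊆ Ico 0 T := fun t ht => ⟨ht.1, ht.2.trans_lt hS⟩
  have hb := (integrable_one_add_norm (E := ℝ) (μ := volume) (r := 1 + δ)
    (by simp; linarith)).const_mul (1 * C)
  refine continuousOn_of_dominated (fun t ht => ?_) (fun t ht => Eventually.of_forall fun x => ?_)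
    hb.integrableOn (Eventually.of_forall fun x => ?_)
  · exact (hk.mul (continuous_space_slice hρ (hsub ht))).aestronglyMeasurable
  · exact abs_mul_decay_le (hC t ht x) (hk1 x)
  · exact ((continuousOn_time_slice hρ x).mono hsub).const_mul (k x)

end FarField

/-- A cumulative mass of the solution, with the constant of integration chosen such that its
gradient is `(ρ, -ρu)`. -/
def cumulMass (ρ u : ℝ → ℝ → ℝ) (x t : ℝ) : ℝ :=
  (∫ y in (0 : ℝ)..x, ρ y t) - ∫ s in (0 : ℝ)..t, ρ 0 s * u 0 s

/-- The part of the force field that depends on time only. -/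
def forceOffset (ρ u : ℝ → ℝ → ℝ) (t : ℝ) : ℝ :=
  2 * (∫ y in Iic 0, ρ y t) - (∫ y, ρ y t) + (∫ y, y * ρ y t)
    + 2 * ∫ s in (0 : ℝ)..t, ρ 0 s * u 0 s

namespace IsSolution

variable {δ T : ℝ} {ρ₀ u₀ : ℝ → ℝ} {ρ u : ℝ → ℝ → ℝ}

theorem neg_force_eq (h : IsSolution δ ρ₀ u₀ T ρ u) (hδ : 0 < δ) {t : ℝ} (ht : t ∈ Ico 0 T)
    (x : ℝ) : -force ρ x t
      = 2 * cumulMass ρ u x t + forceOffset ρ u t - (∫ y, ρ y t) * x := by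
  obtain ⟨C, hC⟩ := h.farField.exists_density_bound hδ h.continuousOn_ρ ht
  have hc := continuous_space_slice h.continuousOn_ρ ht
  have hCt := hC t (right_mem_Icc.2 ht.1)
  have hint := integrable_of_decay hδ hc hCt
  have hint' := integrable_mul_of_decay (A := 1) (k := fun y => y) hδ hc continuous_id hCt
    (fun x => by linarith)
  have hI := intervalIntegral.integral_Iic_sub_Iic (f := fun y => ρ y t) (a := 0) (b := x)
    hint.integrableOn hint.integrableOn
  rw [force, integral_deriv_W_mul hint hint', cumulMass, forceOffset]
  linear_combination 2 * hI

theorem continuousOn_flux (h : IsSolution δ ρ₀ u₀ T ρ u) (x : ℝ) :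
    ContinuousOn (fun s => ρ x s * u x s) (Ico 0 T) :=
  (continuousOn_time_slice h.continuousOn_ρ x).mul
    (continuousOn_time_slice h.contDiffOn_u.continuousOn x)

theorem intervalIntegrable_flux (h : IsSolution δ ρ₀ u₀ T ρ u) (x : ℝ) {t : ℝ}
    (ht : t ∈ Ico 0 T) : IntervalIntegrable (fun s => ρ x s * u x s) volume 0 t := by
  refine ((h.continuousOn_flux x).mono ?_).intervalIntegrable
  rw [uIcc_of_le ht.1]
  exact fun s hs => ⟨hs.1, hs.2.trans_lt ht.2⟩

theorem cumulMass_eq (h : IsSolution δ ρ₀ u₀ T ρ u) (x : ℝ) {t : ℝ} (ht : t ∈ Ico 0 T) :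
    cumulMass ρ u x t = (∫ y in (0 : ℝ)..x, ρ₀ y) - ∫ s in (0 : ℝ)..t, ρ x s * u x s := by
  have hc := h.conservation 0 x t ht
  rw [intervalIntegral.integral_sub (h.intervalIntegrable_flux 0 ht)
    (h.intervalIntegrable_flux x ht)] at hc
  rw [cumulMass, hc]
  ring

theorem hasDerivAt_cumulMass_space (h : IsSolution δ ρ₀ u₀ T ρ u) (x : ℝ) {t : ℝ}
    (ht : t ∈ Ico 0 T) : HasDerivAt (fun y => cumulMass ρ u y t) (ρ x t) x :=
  ((continuous_space_slice h.continuousOn_ρ ht).integral_hasStrictDerivAt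
    0 x).hasDerivAt.sub_const _

theorem hasDerivAt_cumulMass_time (h : IsSolution δ ρ₀ u₀ T ρ u) (x : ℝ) {t : ℝ}
    (ht : t ∈ Ioo 0 T) : HasDerivAt (fun s => cumulMass ρ u x s) (-(ρ x t * u x t)) t := by
  have hco := (h.continuousOn_flux x).mono Ioo_subset_Ico_self
  have h1 := (intervalIntegral.integral_hasDerivAt_right
    (h.intervalIntegrable_flux x (Ioo_subset_Ico_self ht))
    (hco.stronglyMeasurableAtFilter isOpen_Ioo t ht)
    (hco.continuousAt (isOpen_Ioo.mem_nhds ht))).const_sub (∫ y in (0 : ℝ)..x, ρ₀ y)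
  refine h1.congr_of_eventuallyEq ?_
  filter_upwards [isOpen_Ioo.mem_nhds ht] with s hs
  exact h.cumulMass_eq x (Ioo_subset_Ico_self hs)

theorem slab_mem_nhds {x t : ℝ} (ht : t ∈ Ioo 0 T) : (univ ×ˢ Ico 0 T : Set (ℝ × ℝ)) ∈ 𝓝 (x, t) :=
  prod_mem_nhds univ_mem (Ico_mem_nhds ht.1 ht.2)

theorem hasStrictFDerivAt_cumulMass (h : IsSolution δ ρ₀ u₀ T ρ u) {x t : ℝ}
    (ht : t ∈ Ioo 0 T) : HasStrictFDerivAt (fun p : ℝ × ℝ => cumulMass ρ u p.1 p.2)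
      ((ContinuousLinearMap.toSpanSingleton ℝ (ρ x t)).coprod
        (ContinuousLinearMap.toSpanSingleton ℝ (-(ρ x t * u x t)))) (x, t) := by
  have hev : ∀ᶠ v : ℝ × ℝ in 𝓝 (x, t), v.2 ∈ Ioo 0 T :=
    continuousAt_snd.eventually (isOpen_Ioo.mem_nhds ht)
  have hρc : ContinuousAt (fun p : ℝ × ℝ => ρ p.1 p.2) (x, t) :=
    h.continuousOn_ρ.continuousAt (slab_mem_nhds ht)
  have huc : ContinuousAt (fun p : ℝ × ℝ => u p.1 p.2) (x, t) :=
    h.contDiffOn_u.continuousOn.continuousAt (slab_mem_nhds ht)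
  refine hasStrictFDerivAt_uncurry_coprod (𝕜 := ℝ) (u := (x, t)) (f := cumulMass ρ u)
    (f₁ := fun x t => ContinuousLinearMap.toSpanSingleton ℝ (ρ x t))
    (f₂ := fun x t => ContinuousLinearMap.toSpanSingleton ℝ (-(ρ x t * u x t))) ?_ ?_ ?_ ?_
  · filter_upwards [hev] with v hv
    exact (h.hasDerivAt_cumulMass_space v.1 (Ioo_subset_Ico_self hv)).hasFDerivAt
  · filter_upwards [hev] with v hv
    exact (h.hasDerivAt_cumulMass_time v.1 hv).hasFDerivAt
  · exact (ContinuousLinearMap.toSpanSingletonCLE (𝕜 := ℝ) (E := ℝ)).continuous.continuousAt.comp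
      hρc
  · exact (ContinuousLinearMap.toSpanSingletonCLE (𝕜 := ℝ) (E := ℝ)).continuous.continuousAt.comp
      (hρc.mul huc).neg

theorem continuousOn_cumulMass (h : IsSolution δ ρ₀ u₀ T ρ u) (hδ : 0 < δ) {S : ℝ}
    (hS : S ∈ Ico 0 T) :
    ContinuousOn (fun p : ℝ × ℝ => cumulMass ρ u p.1 p.2) (univ ×ˢ Icc 0 S) := by
  have hsub : Icc 0 S ⊆ Ico 0 T := fun t ht => ⟨ht.1, ht.2.trans_lt hS.2⟩
  obtain ⟨C, hC⟩ := h.farField.exists_density_bound hδ h.continuousOn_ρ hS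
  have hC0 : 0 ≤ C := by
    have := (abs_nonneg _).trans (hC 0 (left_mem_Icc.2 hS.1) 0)
    simpa using this
  have hC' : ∀ t ∈ Icc 0 S, ∀ x, |ρ x t| ≤ C := fun t ht x => (hC t ht x).trans
    (mul_le_of_le_one_right hC0 (Real.rpow_le_one_of_one_le_of_nonpos
      (by linarith [abs_nonneg x]) (by linarith)))
  refine continuousOn_prod_of_continuousOn_lipschitzOnWith _ ⟨C, hC0⟩ (fun x _ => ?_)
    fun t ht => ?_
  · refine ContinuousOn.congr (f := fun t => (∫ y in (0 : ℝ)..x, ρ₀ y)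
      - ∫ s in (0 : ℝ)..t, ρ x s * u x s) ?_ fun t ht => h.cumulMass_eq x (hsub ht)
    refine continuousOn_const.sub ?_
    have := intervalIntegral.continuousOn_primitive_interval (μ := volume)
      (f := fun s => ρ x s * u x s) (a := 0) (b := S)
      (((h.continuousOn_flux x).mono (by rwa [uIcc_of_le hS.1])).integrableOn_compact
        isCompact_uIcc)
    rwa [uIcc_of_le hS.1] at this
  · refine LipschitzOnWith.of_dist_le_mul fun x _ y _ => ?_
    refine Convex.norm_image_sub_le_of_norm_hasDerivWithin_le (s := univ) (C := C)
      (f := fun y => cumulMass ρ u y t) (f' := fun y => ρ y t)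
      (fun z _ => (h.hasDerivAt_cumulMass_space z (hsub ht)).hasDerivWithinAt)
      (fun z _ => hC' t ht z) convex_univ (mem_univ y) (mem_univ x)

/-- Any curve solving the Newton equation that the momentum equation forces on particles is a
characteristic, and the cumulative mass is constant along it: the velocity defect `V - u(X,t)` and
the mass defect solve a homogeneous linear system. In this way the characteristic equation
`X' = u(X, t)` is solved without any bound on `u`. -/
theorem velocity_eq_and_cumulMass_eq (h : IsSolution δ ρ₀ u₀ T ρ u) (hδ : 0 < δ) {S : ℝ}
    (hS : S ∈ Ico 0 T) {x : ℝ} {X V : ℝ → ℝ} (hX0 : X 0 = x) (hV0 : V 0 = u₀ x)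
    (hXc : ContinuousOn X (Icc 0 S)) (hVc : ContinuousOn V (Icc 0 S))
    (hX : ∀ t ∈ Ioo 0 S, HasDerivAt X (V t) t)
    (hV : ∀ t ∈ Ioo 0 S, HasDerivAt V (-V t - (∫ y, ρ y t) * X t
      + (2 * (∫ y in (0 : ℝ)..x, ρ₀ y) + forceOffset ρ u t)) t) {t : ℝ} (ht : t ∈ Icc 0 S) :
    V t = u (X t) t ∧ cumulMass ρ u (X t) t = ∫ y in (0 : ℝ)..x, ρ₀ y := by
  have hsub : Icc 0 S ⊆ Ico 0 T := fun t ht => ⟨ht.1, ht.2.trans_lt hS.2⟩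
  have hsub' : Ioo 0 S ⊆ Ioo 0 T := Ioo_subset_Ioo_right hS.2.le
  have hcurve : ContinuousOn (fun t => (X t, t)) (Icc 0 S) := hXc.prodMk continuousOn_id
  have hmaps : MapsTo (fun t => (X t, t)) (Icc 0 S) (univ ×ˢ Ico 0 T) :=
    fun t ht => ⟨mem_univ _, hsub ht⟩
  have huX : ContinuousOn (fun t => u (X t) t) (Icc 0 S) :=
    h.contDiffOn_u.continuousOn.comp hcurve hmaps
  have hρX : ContinuousOn (fun t => ρ (X t) t) (Icc 0 S) :=
    h.continuousOn_ρ.comp hcurve hmaps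
  have hGX : ContinuousOn (fun t => cumulMass ρ u (X t) t) (Icc 0 S) :=
    (h.continuousOn_cumulMass hδ hS).comp hcurve fun t ht => ⟨mem_univ _, ht⟩
  set U : ℝ × ℝ → ℝ := fun p => u p.1 p.2 with hU
  set U' := fun p => fderivWithin ℝ U (univ ×ˢ Ico 0 T) p with hU'
  have hU'c : ContinuousOn (fun t => U' (X t, t) (1, 0)) (Icc 0 S) :=
    ((h.contDiffOn_u.continuousOn_fderivWithin (uniqueDiffOn_univ.prod (uniqueDiffOn_Ico 0 T))
      le_rfl).comp hcurve hmaps).clm_apply continuousOn_const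
  obtain ⟨K₁, hK₁⟩ := isCompact_Icc.exists_bound_of_continuousOn hU'c
  obtain ⟨K₂, hK₂⟩ := isCompact_Icc.exists_bound_of_continuousOn hρX
  have h0S := left_mem_Icc.2 hS.1
  have hK₁0 : 0 ≤ K₁ := (norm_nonneg _).trans (hK₁ 0 h0S)
  have hK₂0 : 0 ≤ K₂ := (norm_nonneg _).trans (hK₂ 0 h0S)
  have hUd : ∀ t ∈ Ioo 0 S, HasFDerivAt U (U' (X t, t)) (X t, t) := fun t ht =>
    ((h.contDiffOn_u.differentiableOn one_ne_zero _
      (hmaps (Ioo_subset_Icc_self ht))).hasFDerivWithinAt).hasFDerivAt (slab_mem_nhds (hsub' ht))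
  have key := linear_system_eq_zero (S := S) (K := 2 + K₁ + K₂) (D := fun t => V t - u (X t) t)
    (E := fun t => (∫ y in (0 : ℝ)..x, ρ₀ y) - cumulMass ρ u (X t) t)
    (α := fun t => -(1 + U' (X t, t) (1, 0))) (β := fun _ => 2) (γ := fun t => -ρ (X t) t)
    (η := fun _ => 0) (hVc.sub huX) (continuousOn_const.sub hGX) ?_ ?_ ?_ ?_ ?_ ?_ ?_ ?_ ht
  · exact ⟨sub_eq_zero.1 key.1, (sub_eq_zero.1 key.2).symm⟩
  · intro t ht
    have hLx : HasDerivAt (fun y => u y t) (U' (X t, t) (1, 0)) (X t) :=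
      hasDerivAt_space_slice (hUd t ht)
    have hLt : HasDerivAt (fun s => u (X t) s) (U' (X t, t) (0, 1)) t :=
      hasDerivAt_time_slice (hUd t ht)
    have hUX : HasDerivAt (fun t => u (X t) t) (U' (X t, t) (V t, 1)) t :=
      hasDerivAt_along_curve (hUd t ht) (hX t ht)
    have hsplit : U' (X t, t) (V t, 1) = V t * U' (X t, t) (1, 0) + U' (X t, t) (0, 1) := by
      have : ((V t, 1) : ℝ × ℝ) = V t • (1, 0) + (0, 1) := by simp
      rw [this, map_add, map_smul, smul_eq_mul]
    have hmom := h.momentum_eq (X t) t (hsub' ht)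
    rw [hLx.deriv, hLt.deriv, h.neg_force_eq hδ (hsub (Ioo_subset_Icc_self ht))] at hmom
    refine ((hV t ht).sub hUX).congr_deriv ?_
    rw [hsplit]
    linear_combination -hmom
  · intro t ht
    have hG := hasDerivAt_along_curve
      (h.hasStrictFDerivAt_cumulMass (x := X t) (hsub' ht)).hasFDerivAt (hX t ht)
    refine (hG.const_sub _).congr_deriv ?_
    simp
    ring
  · intro t ht
    have := hK₁ t (Ioo_subset_Icc_self ht)
    rw [Real.norm_eq_abs] at this
    rw [abs_neg]
    refine (abs_add_le _ _).trans ?_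
    rw [abs_one]
    linarith
  · intro t _
    rw [abs_of_pos two_pos]
    linarith
  · intro t ht
    have := hK₂ t (Ioo_subset_Icc_self ht)
    rw [Real.norm_eq_abs] at this
    rw [abs_neg]
    linarith
  · intro t _
    rw [abs_zero]
    positivity
  · simp [hX0, hV0, h.initial_u]
  · have h0T : (0 : ℝ) ∈ Ico 0 T := hsub h0S
    simp [h.cumulMass_eq _ h0T, hX0]

end IsSolution

/-! ### Positivity of the Jacobian of the flow of a solution -/

/-- Assumptions on the initial data, with the decay of the density in the form of an integrable
majorant. -/
structure InitialData (δ : ℝ) (ρ₀ u₀ : ℝ → ℝ) (Cρ Cu : ℝ) : Prop where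
  delta_pos : 0 < δ
  pos : ∀ x, 0 < ρ₀ x
  contDiff_ρ : ContDiff ℝ 1 ρ₀
  contDiff_u : ContDiff ℝ 1 u₀
  deriv_u_le : ∀ x, |deriv u₀ x| ≤ Cu
  decay : ∀ x, |ρ₀ x| ≤ Cρ * (1 + |x|) ^ (-(2 + δ))

namespace InitialData

variable {δ Cρ Cu : ℝ} {ρ₀ u₀ : ℝ → ℝ}

theorem continuous_deriv_u (h : InitialData δ ρ₀ u₀ Cρ Cu) : Continuous (deriv u₀) :=
  h.contDiff_u.continuous_deriv le_rfl

theorem hasDerivAt_u (h : InitialData δ ρ₀ u₀ Cρ Cu) (x : ℝ) :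
    HasDerivAt u₀ (deriv u₀ x) x :=
  (h.contDiff_u.differentiable one_ne_zero x).hasDerivAt

theorem integrable (h : InitialData δ ρ₀ u₀ Cρ Cu) : Integrable ρ₀ :=
  integrable_of_decay h.delta_pos h.contDiff_ρ.continuous h.decay

theorem tendsto_zero (h : InitialData δ ρ₀ u₀ Cρ Cu) : Tendsto ρ₀ (cocompact ℝ) (𝓝 0) := by
  have h1 := (tendsto_one_add_abs_rpow_neg (s := 2 + δ) (by linarith [h.delta_pos])).const_mul Cρ
  rw [mul_zero] at h1
  exact squeeze_zero_norm (fun x => h.decay x) h1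

theorem mass_pos (h : InitialData δ ρ₀ u₀ Cρ Cu) : 0 < ∫ x, ρ₀ x := by
  rw [integral_pos_iff_support_of_nonneg (fun x => (h.pos x).le) h.integrable]
  have : Function.support ρ₀ = univ := eq_univ_of_forall fun x => (h.pos x).ne'
  simp [this]

end InitialData

theorem setIntegral_univ_of_surjective {f f' g h : ℝ → ℝ} (hf : ∀ x, HasDerivAt f (f' x) x)
    (hf' : ∀ x, 0 < f' x) (hmono : StrictMono f) (hsurj : Function.Surjective f)
    (hgh : ∀ x, h x = g (f x) * f' x) : ∫ y, g y = ∫ x, h x := by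
  have := setIntegral_image_of_strictMono hf hf' hmono hgh MeasurableSet.univ
  rwa [image_univ, hsurj.range_eq, setIntegral_univ, setIntegral_univ] at this

/-- The Jacobian of the flow of a solution is positive as long as the solution exists. It is
computed from a flow built with the a priori unknown total mass `∫ ρ(·,t)`; its uniform positivity
makes the flow map onto, so that the total mass is conserved, and the Jacobian is `stretch`. -/
theorem IsSolution.stretch_pos {δ T Cρ Cu : ℝ} {ρ₀ u₀ : ℝ → ℝ} {ρ u : ℝ → ℝ → ℝ}
    (h : IsSolution δ ρ₀ u₀ T ρ u) (h₀ : InitialData δ ρ₀ u₀ Cρ Cu) {φ φ' : ℝ → ℝ}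
    (hφ : IsDampedOscillator (∫ x, ρ₀ x) φ φ') (hφ0 : φ 0 = 0) (hφ0' : φ' 0 = 1) {t : ℝ}
    (ht : t ∈ Ico 0 T) (x : ℝ) : 0 < stretch (∫ x, ρ₀ x) φ φ' (ρ₀ x) (deriv u₀ x) t := by
  obtain ⟨S, htS, hST⟩ := exists_between ht.2
  have hδ := h₀.delta_pos
  have hS0 : 0 ≤ S := ht.1.trans htS.le
  have hS : S ∈ Ico 0 T := ⟨hS0, hST⟩
  have hsub : Icc 0 S ⊆ Ico 0 T := fun t ht => ⟨ht.1, ht.2.trans_lt hST⟩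
  obtain ⟨C, hC⟩ := h.farField.exists_density_bound hδ h.continuousOn_ρ hS
  set μ : ℝ → ℝ := fun t => ∫ y, ρ y t with hμdef
  have hμ : ContinuousOn μ (Icc 0 S) := by
    simpa using continuousOn_setIntegral_density hδ hST h.continuousOn_ρ hC
      (k := fun _ => 1) continuous_const (fun x => by simp) univ
  have hoff : ContinuousOn (forceOffset ρ u) (Icc 0 S) := by
    have h1 : ContinuousOn (fun t => ∫ y in Iic 0, ρ y t) (Icc 0 S) := by
      simpa using continuousOn_setIntegral_density hδ hST h.continuousOn_ρ hC
        (k := fun _ => 1) continuous_const (fun x => by simp) (Iic 0)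
    have h2 : ContinuousOn (fun t => ∫ y, y * ρ y t) (Icc 0 S) := by
      simpa using continuousOn_setIntegral_density hδ hST h.continuousOn_ρ hC
        (k := fun y => y) continuous_id (fun x => by simp) univ
    have h3 : ContinuousOn (fun t => ∫ s in (0 : ℝ)..t, ρ 0 s * u 0 s) (Icc 0 S) := by
      have := intervalIntegral.continuousOn_primitive_interval (μ := volume)
        (f := fun s => ρ 0 s * u 0 s) (a := 0) (b := S)
        (((h.continuousOn_flux 0).mono (by rwa [uIcc_of_le hS0])).integrableOn_compact
          isCompact_uIcc)
      rwa [uIcc_of_le hS0] at this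
    unfold forceOffset
    exact (((h1.const_mul 2).sub hμ).add h2).add (h3.const_mul 2)
  obtain ⟨φ₁, φ₁', h1a, h1b, h1c, h1c', h1d, h1d'⟩ :=
    exists_damped hS0 hμ (continuousOn_const (c := (0 : ℝ))) 1 0
  obtain ⟨φ₂, φ₂', h2a, h2b, h2c, h2c', h2d, h2d'⟩ :=
    exists_damped hS0 hμ (continuousOn_const (c := (0 : ℝ))) 0 1
  obtain ⟨φ₃, φ₃', h3a, h3b, h3c, h3c', h3d, h3d'⟩ :=
    exists_damped hS0 hμ (continuousOn_const (c := (1 : ℝ))) 0 0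
  obtain ⟨ψ, ψ', h4a, h4b, h4c, h4c', h4d, h4d'⟩ := exists_damped hS0 hμ hoff 0 0
  set F : ℝ → ℝ := fun x => ∫ y in (0 : ℝ)..x, ρ₀ y with hF
  have hFd : ∀ x, HasDerivAt F (ρ₀ x) x := fun x =>
    (h₀.contDiff_ρ.continuous.integral_hasStrictDerivAt 0 x).hasDerivAt
  set X : ℝ → ℝ → ℝ := fun x t => x * φ₁ t + u₀ x * φ₂ t + 2 * F x * φ₃ t + ψ t with hX
  set w : ℝ → ℝ → ℝ := fun x t => φ₁ t + deriv u₀ x * φ₂ t + 2 * ρ₀ x * φ₃ t with hw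
  have hXd : ∀ t x, HasDerivAt (fun x => X x t) (w x t) x := fun t x =>
    (((((hasDerivAt_id x).mul_const (φ₁ t)).add ((h₀.hasDerivAt_u x).mul_const (φ₂ t))).add
      (((hFd x).const_mul 2).mul_const (φ₃ t))).add_const (ψ t)).congr_deriv (by simp [hw])
  have hmassX : ∀ x, ∀ t ∈ Icc 0 S, cumulMass ρ u (X x t) t = F x := fun x t ht =>
    (h.velocity_eq_and_cumulMass_eq hδ hS (x := x) (X := X x)
      (V := fun t => x * φ₁' t + u₀ x * φ₂' t + 2 * F x * φ₃' t + ψ' t)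
      (by simp [hX, h1a, h2a, h3a, h4a]) (by simp [h1b, h2b, h3b, h4b])
      (by simp only [hX]; fun_prop) (by fun_prop)
      (fun t ht => ((((h1d t ht).const_mul x).add ((h2d t ht).const_mul (u₀ x))).add
        ((h3d t ht).const_mul (2 * F x))).add (h4d t ht))
      (fun t ht => (((((h1d' t ht).const_mul x).add ((h2d' t ht).const_mul (u₀ x))).add
        ((h3d' t ht).const_mul (2 * F x))).add (h4d' t ht)).congr_deriv
          (by simp only [hX, hμdef]; ring)) ht).2
  have hρw : ∀ x, ∀ t ∈ Icc 0 S, ρ₀ x = ρ (X x t) t * w x t := by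
    intro x t ht
    have h1 := (h.hasDerivAt_cumulMass_space (X x t) (hsub ht)).comp x (hXd t x)
    have h2 : (fun y => cumulMass ρ u y t) ∘ (fun x => X x t) = F :=
      funext fun y => hmassX y t ht
    rw [h2] at h1
    exact (hFd x).unique h1
  have hwc : ∀ x, ContinuousOn (w x) (Icc 0 S) := fun x => by simp only [hw]; fun_prop
  have hw0 : ∀ x, w x 0 = 1 := fun x => by simp [hw, h1a, h2a, h3a]
  have hwpos : ∀ x, ∀ t ∈ Icc 0 S, 0 < w x t := by
    intro x t ht
    by_contra! hle
    have hsub' : Icc 0 t ⊆ Icc 0 S := Icc_subset_Icc_right ht.2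
    obtain ⟨s, hs, hs0⟩ := intermediate_value_Icc' ht.1 ((hwc x).mono hsub')
      (show (0 : ℝ) ∈ Icc (w x t) (w x 0) from ⟨hle, by rw [hw0]; norm_num⟩)
    have := hρw x s (hsub' hs)
    rw [hs0, mul_zero] at this
    exact (h₀.pos x).ne' this
  -- The Wronskian is `e^{-t}`.
  have hWr : ∀ t ∈ Ioo 0 S, φ₁ t * φ₂' t - φ₁' t * φ₂ t ≠ 0 := by
    intro t ht
    have key := linear_system_eq_zero (S := S) (K := 1)
      (D := fun t => φ₁ t * φ₂' t - φ₁' t * φ₂ t - Real.exp (-1 * t)) (E := fun _ => 0)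
      (α := fun _ => -1) (β := fun _ => 0) (γ := fun _ => 0) (η := fun _ => 0)
      (by fun_prop) continuousOn_const
      (fun s hs => ((((h1d s hs).mul (h2d' s hs)).sub ((h1d' s hs).mul (h2d s hs))).sub
        (hasDerivAt_exp_const_mul (-1) s)).congr_deriv (by ring))
      (fun s _ => by simpa using hasDerivAt_const s (0 : ℝ))
      (by simp) (by simp) (by simp) (by simp) (by simp [h1a, h1b, h2a, h2b]) rfl
      (Ioo_subset_Icc_self ht)
    rw [sub_eq_zero.1 key.1]
    exact (Real.exp_pos _).ne'
  have hmass : ∀ s ∈ Ioo 0 S, μ s = ∫ x, ρ₀ x := by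
    intro s hs
    obtain ⟨c, hc, hcw⟩ := exists_pos_lower_bound (S := S) (S' := s) hs.2
      h₀.contDiff_ρ.continuous h₀.continuous_deriv_u h₀.pos h₀.tendsto_zero h₀.deriv_u_le
      h1c h2c h3c h1d h2d hWr h1a h2a (fun x t ht => hwpos x t (Ico_subset_Icc_self ht))
    obtain ⟨hm, hsurj⟩ := strictMono_and_surjective_of_deriv_ge hc (hXd s)
      (fun x => hcw x s ⟨hs.1.le, le_rfl⟩)
    exact setIntegral_univ_of_surjective (hXd s) (fun x => hwpos x s (Ioo_subset_Icc_self hs)) hm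
      hsurj (fun x => hρw x s (Ioo_subset_Icc_self hs))
  set M := ∫ x, ρ₀ x with hM
  have hM0 : 0 < M := h₀.mass_pos
  set r := ρ₀ x with hr
  set d := deriv u₀ x with hd
  have hsd : ∀ t, HasDerivAt (stretch M φ φ' r d)
      ((1 - 2 * r / M) * (-M * φ t) + d * φ' t) t := fun t =>
    (((((hφ.hasDerivAt t).add (hφ.hasDerivAt' t)).const_mul (1 - 2 * r / M)).add
      ((hφ.hasDerivAt t).const_mul d)).const_add (2 * r / M)).congr_deriv (by ring)
  have hsd' : ∀ t, HasDerivAt (fun t => (1 - 2 * r / M) * (-M * φ t) + d * φ' t)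
      ((1 - 2 * r / M) * (-M * φ' t) + d * (-φ' t - M * φ t)) t := fun t =>
    (((hφ.hasDerivAt t).const_mul (-M)).const_mul (1 - 2 * r / M)).add
      ((hφ.hasDerivAt' t).const_mul d)
  have hsc : Continuous (stretch M φ φ' r d) :=
    continuous_iff_continuousAt.2 fun t => (hsd t).continuousAt
  have hφc := hφ.continuous
  have hφc' := hφ.continuous'
  -- Now that the mass is known, `w` and `stretch` solve the same initial value problem.
  have key := linear_system_eq_zero (S := S) (K := 1 + M)
    (D := fun t => w x t - stretch M φ φ' r d t)
    (E := fun t => (φ₁' t + d * φ₂' t + 2 * r * φ₃' t)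
      - ((1 - 2 * r / M) * (-M * φ t) + d * φ' t))
    (α := fun _ => 0) (β := fun _ => 1) (γ := fun _ => -M) (η := fun _ => -1)
    ((hwc x).sub hsc.continuousOn) (by fun_prop)
    (fun s hs => ((((h1d s hs).add ((h2d s hs).const_mul d)).add
      ((h3d s hs).const_mul (2 * r))).sub (hsd s)).congr_deriv (by ring))
    (fun s hs => ((((h1d' s hs).add ((h2d' s hs).const_mul d)).add
      ((h3d' s hs).const_mul (2 * r))).sub (hsd' s)).congr_deriv (by
        rw [hmass s hs]; simp only [hw, stretch]; field_simp; ring))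
    (fun s _ => by simp; positivity) (fun s _ => by simpa using hM0.le)
    (fun s _ => by rw [abs_neg, abs_of_pos hM0]; linarith) (fun s _ => by simpa using hM0.le)
    (by simp [hw0, stretch, hφ0, hφ0']) (by simp [h1b, h2b, h3b, hφ0, hφ0'])
    (t := t) ⟨ht.1, htS.le⟩
  rw [← sub_eq_zero.1 key.1]
  exact hwpos x t ⟨ht.1, htS.le⟩

/-! ### Inversion of a flow map -/

/-- On the open time interval `I`, `X` is a flow map with velocity `V` and Jacobian `w` (both in
Lagrangian variables), and `X(·,t)` is an increasing diffeomorphism of the line. -/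
structure IsFlow (I : Set ℝ) (X V w : ℝ → ℝ → ℝ) : Prop where
  isOpen : IsOpen I
  contDiff_X : ContDiff ℝ 1 fun p : ℝ × ℝ => X p.1 p.2
  contDiff_V : ContDiff ℝ 1 fun p : ℝ × ℝ => V p.1 p.2
  continuous_w : Continuous fun p : ℝ × ℝ => w p.1 p.2
  hasDerivAt_space : ∀ x t, HasDerivAt (fun x => X x t) (w x t) x
  hasDerivAt_time : ∀ x t, HasDerivAt (fun t => X x t) (V x t) t
  w_pos : ∀ x, ∀ t ∈ I, 0 < w x t
  strictMono : ∀ t ∈ I, StrictMono fun x => X x t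
  surjective : ∀ t ∈ I, Function.Surjective fun x => X x t

namespace IsFlow

variable {I : Set ℝ} {X V w : ℝ → ℝ → ℝ}

theorem hasFDerivAt (h : IsFlow I X V w) (x t : ℝ) :
    HasFDerivAt (fun p : ℝ × ℝ => X p.1 p.2)
      (w x t • ContinuousLinearMap.fst ℝ ℝ ℝ + V x t • ContinuousLinearMap.snd ℝ ℝ ℝ) (x, t) := by
  have hd := (h.contDiff_X.differentiable one_ne_zero (x, t)).hasFDerivAt
  refine hd.congr_fderiv ?_
  have h1 := (h.hasDerivAt_space x t).unique (hasDerivAt_space_slice hd)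
  have h2 := (h.hasDerivAt_time x t).unique (hasDerivAt_time_slice hd)
  refine ContinuousLinearMap.ext fun p => ?_
  have hp : p = p.1 • (1, 0) + p.2 • (0, 1) := by ext <;> simp
  rw [hp, map_add, map_smul, map_smul, ← h1, ← h2]
  simp
  ring

/-- The inverse `Y(·,t)` of the flow map is jointly of class `C¹`, by the inverse function theorem
for `(x, t) ↦ (X(x,t), t)`. -/
theorem exists_inverse (h : IsFlow I X V w) :
    ∃ Y : ℝ → ℝ → ℝ, (∀ t ∈ I, ∀ z, X (Y z t) t = z) ∧ (∀ t ∈ I, ∀ x, Y (X x t) t = x) ∧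
      ContDiffOn ℝ 1 (fun p : ℝ × ℝ => Y p.1 p.2) (univ ×ˢ I) := by
  set Y : ℝ → ℝ → ℝ := fun z t => Function.invFun (fun x => X x t) z with hY
  have hXY : ∀ t ∈ I, ∀ z, X (Y z t) t = z := fun t ht z =>
    Function.rightInverse_invFun (h.surjective t ht) z
  have hYX : ∀ t ∈ I, ∀ x, Y (X x t) t = x := fun t ht x =>
    Function.leftInverse_invFun (h.strictMono t ht).injective x
  refine ⟨Y, hXY, hYX, ?_⟩
  rintro ⟨z, t⟩ ⟨-, ht⟩
  refine ContDiffAt.contDiffWithinAt ?_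
  set x := Y z t with hx
  have hw := (h.w_pos x t ht).ne'
  set f : ℝ × ℝ → ℝ × ℝ := fun p => (X p.1 p.2, p.2) with hf
  have hfc : ContDiffAt ℝ 1 f (x, t) := (h.contDiff_X.prodMk contDiff_snd).contDiffAt
  set L : (ℝ × ℝ) ≃L[ℝ] ℝ × ℝ := ContinuousLinearEquiv.equivOfInverse
    ((w x t • ContinuousLinearMap.fst ℝ ℝ ℝ + V x t • ContinuousLinearMap.snd ℝ ℝ ℝ).prod
      (ContinuousLinearMap.snd ℝ ℝ ℝ))
    (((w x t)⁻¹ • (ContinuousLinearMap.fst ℝ ℝ ℝ - V x t • ContinuousLinearMap.snd ℝ ℝ ℝ)).prod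
      (ContinuousLinearMap.snd ℝ ℝ ℝ))
    (fun p => by ext <;> simp [hw]) (fun p => by ext <;> simp [hw]) with hL
  have hfd : HasFDerivAt f (L : ℝ × ℝ →L[ℝ] ℝ × ℝ) (x, t) :=
    (h.hasFDerivAt x t).prodMk hasFDerivAt_snd
  have hfx : f (x, t) = (z, t) := by simp only [hf, hx, hXY t ht]
  have hg := hfc.to_localInverse hfd one_ne_zero
  have hright : ∀ᶠ q in 𝓝 (f (x, t)), f (hfc.localInverse hfd one_ne_zero q) = q :=
    (hfc.hasStrictFDerivAt' hfd one_ne_zero).eventually_right_inverse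
  rw [hfx] at hg hright
  refine (contDiffAt_fst.comp (z, t) hg).congr_of_eventuallyEq ?_
  have hev : ∀ᶠ q : ℝ × ℝ in 𝓝 (z, t), q.2 ∈ I :=
    continuousAt_snd.eventually (h.isOpen.mem_nhds ht)
  filter_upwards [hright, hev] with q hq hqI
  have h2 := congrArg Prod.snd hq
  have h1 := congrArg Prod.fst hq
  simp only [hf] at h1 h2
  rw [h2] at h1
  simp only [Function.comp]
  rw [← h1, hYX q.2 hqI]

variable {Y : ℝ → ℝ → ℝ}

theorem hasDerivAt_inverse (h : IsFlow I X V w) (hXY : ∀ t ∈ I, ∀ z, X (Y z t) t = z)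
    (hYX : ∀ t ∈ I, ∀ x, Y (X x t) t = x)
    (hY : ContDiffOn ℝ 1 (fun p : ℝ × ℝ => Y p.1 p.2) (univ ×ˢ I)) {z t : ℝ} (ht : t ∈ I) :
    HasDerivAt (fun z => Y z t) (1 / w (Y z t) t) z ∧
      HasDerivAt (fun t => Y z t) (-(V (Y z t) t) / w (Y z t) t) t := by
  have hd := ((hY.contDiffAt (prod_mem_nhds univ_mem (h.isOpen.mem_nhds ht))).differentiableAt
    one_ne_zero : DifferentiableAt ℝ (fun p : ℝ × ℝ => Y p.1 p.2) (z, t)).hasFDerivAt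
  set L := fderiv ℝ (fun p : ℝ × ℝ => Y p.1 p.2) (z, t)
  have hw := (h.w_pos (Y z t) t ht).ne'
  have hz := hasDerivAt_space_slice hd
  have ht' := hasDerivAt_time_slice hd
  have h1 : L (1, 0) * w (Y z t) t = 1 := by
    have hz' : HasDerivAt (fun z => Y z t) (L (1, 0)) (X (Y z t) t) := by rwa [hXY t ht]
    have hc := hz'.comp (Y z t) (h.hasDerivAt_space (Y z t) t)
    have hid : (fun z => Y z t) ∘ (fun x => X x t) = id := funext fun x => hYX t ht x
    rw [hid] at hc
    exact hc.unique (hasDerivAt_id _)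
  have h2 : V (Y z t) t * L (1, 0) + L (0, 1) = 0 := by
    have hd' : HasFDerivAt (fun p : ℝ × ℝ => Y p.1 p.2) L (X (Y z t) t, t) := by
      rwa [hXY t ht]
    have hc := hasDerivAt_along_curve hd' (h.hasDerivAt_time (Y z t) t)
    have hcst : HasDerivAt (fun s => Y (X (Y z t) s) s) 0 t := by
      refine (hasDerivAt_const t (Y z t)).congr_of_eventuallyEq ?_
      filter_upwards [h.isOpen.mem_nhds ht] with s hs
      exact hYX s hs _
    have hu := hc.unique hcst
    have hsplit : ((V (Y z t) t, 1) : ℝ × ℝ) = V (Y z t) t • (1, 0) + (0, 1) := by simp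
    rwa [hsplit, map_add, map_smul, smul_eq_mul] at hu
  have h1' : L (1, 0) = 1 / w (Y z t) t := by rw [eq_div_iff hw, h1]
  refine ⟨h1' ▸ hz, ?_⟩
  have h2' : L (0, 1) = -(V (Y z t) t) / w (Y z t) t := by
    rw [h1'] at h2
    rw [eq_div_iff hw]
    field_simp at h2
    linarith
  exact h2' ▸ ht'

end IsFlow

/-! ### Explicit Lagrangian flows -/

/-- Functions of the Lagrangian variable `x` and of time that are combinations of `1`, `x`, `u₀ x`
and `F x` with coefficients depending on time. -/
def lagrangian (u₀ F α₀ α₁ α₂ α₃ : ℝ → ℝ) (x t : ℝ) : ℝ :=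
  α₀ t + x * α₁ t + u₀ x * α₂ t + F x * α₃ t

section Lagrangian

variable {u₀ F α₀ α₁ α₂ α₃ β₀ β₁ β₂ β₃ : ℝ → ℝ}

theorem contDiff_lagrangian (hu : ContDiff ℝ 1 u₀) (hF : ContDiff ℝ 1 F) (h₀ : ContDiff ℝ 1 α₀)
    (h₁ : ContDiff ℝ 1 α₁) (h₂ : ContDiff ℝ 1 α₂) (h₃ : ContDiff ℝ 1 α₃) :
    ContDiff ℝ 1 fun p : ℝ × ℝ => lagrangian u₀ F α₀ α₁ α₂ α₃ p.1 p.2 := by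
  unfold lagrangian
  fun_prop

theorem hasDerivAt_lagrangian_space {a b x : ℝ} (hu : HasDerivAt u₀ a x) (hF : HasDerivAt F b x)
    (t : ℝ) : HasDerivAt (fun x => lagrangian u₀ F α₀ α₁ α₂ α₃ x t)
      (α₁ t + a * α₂ t + b * α₃ t) x :=
  (((((hasDerivAt_id x).mul_const (α₁ t)).const_add (α₀ t)).add (hu.mul_const (α₂ t))).add
    (hF.mul_const (α₃ t))).congr_deriv (by ring)

theorem hasDerivAt_lagrangian_time {t : ℝ} (h₀ : HasDerivAt α₀ (β₀ t) t)
    (h₁ : HasDerivAt α₁ (β₁ t) t) (h₂ : HasDerivAt α₂ (β₂ t) t) (h₃ : HasDerivAt α₃ (β₃ t) t)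
    (x : ℝ) : HasDerivAt (fun t => lagrangian u₀ F α₀ α₁ α₂ α₃ x t)
      (lagrangian u₀ F β₀ β₁ β₂ β₃ x t) t :=
  ((h₀.add (h₁.const_mul x)).add (h₂.const_mul (u₀ x))).add (h₃.const_mul (F x))

theorem exists_lagrangian_bound {A B : ℝ} (hu : ∀ x, |u₀ x| ≤ A * (1 + |x|))
    (hF : ∀ x, |F x| ≤ B) (h₀ : Continuous α₀) (h₁ : Continuous α₁) (h₂ : Continuous α₂)
    (h₃ : Continuous α₃) (S : ℝ) :
    ∃ K, 0 ≤ K ∧ ∀ x, ∀ t ∈ Icc 0 S, |lagrangian u₀ F α₀ α₁ α₂ α₃ x t| ≤ K * (1 + |x|) := by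
  obtain ⟨K₀, hK₀⟩ := (isCompact_Icc (a := (0 : ℝ)) (b := S)).exists_bound_of_continuousOn
    h₀.continuousOn
  obtain ⟨K₁, hK₁⟩ := (isCompact_Icc (a := (0 : ℝ)) (b := S)).exists_bound_of_continuousOn
    h₁.continuousOn
  obtain ⟨K₂, hK₂⟩ := (isCompact_Icc (a := (0 : ℝ)) (b := S)).exists_bound_of_continuousOn
    h₂.continuousOn
  obtain ⟨K₃, hK₃⟩ := (isCompact_Icc (a := (0 : ℝ)) (b := S)).exists_bound_of_continuousOn
    h₃.continuousOn
  have hA : 0 ≤ A := by simpa using (abs_nonneg _).trans (hu 0)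
  have hB : 0 ≤ B := (abs_nonneg _).trans (hF 0)
  refine ⟨|K₀| + |K₁| + A * |K₂| + B * |K₃|, by positivity, fun x t ht => ?_⟩
  have hx := abs_nonneg x
  have k₀ : |α₀ t| ≤ |K₀| * (1 + |x|) :=
    ((hK₀ t ht).trans (le_abs_self _)).trans (le_mul_of_one_le_right (abs_nonneg _) (by linarith))
  have k₁ : |x * α₁ t| ≤ |K₁| * (1 + |x|) := by
    rw [abs_mul, mul_comm]
    exact mul_le_mul ((hK₁ t ht).trans (le_abs_self _)) (by linarith) hx (abs_nonneg _)
  have k₂ : |u₀ x * α₂ t| ≤ A * |K₂| * (1 + |x|) := by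
    rw [abs_mul, mul_right_comm]
    exact mul_le_mul (hu x) ((hK₂ t ht).trans (le_abs_self _)) (abs_nonneg _) (by positivity)
  have k₃ : |F x * α₃ t| ≤ B * |K₃| * (1 + |x|) := by
    rw [abs_mul]
    refine (mul_le_mul (hF x) ((hK₃ t ht).trans (le_abs_self _)) (abs_nonneg _) hB).trans ?_
    exact le_mul_of_one_le_right (by positivity) (by linarith)
  unfold lagrangian
  calc _ ≤ |α₀ t| + |x * α₁ t| + |u₀ x * α₂ t| + |F x * α₃ t| :=
        (abs_add_le _ _).trans (add_le_add_left ((abs_add_le _ _).trans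
          (add_le_add_left (abs_add_le _ _) _)) _)
    _ ≤ _ := by linarith

end Lagrangian

/-! ### From a Lagrangian flow to a solution -/

namespace InitialData

variable {δ Cρ Cu : ℝ} {ρ₀ u₀ : ℝ → ℝ}

theorem integral_Iic_eq (h : InitialData δ ρ₀ u₀ Cρ Cu) (x : ℝ) :
    ∫ y in Iic x, ρ₀ y = (∫ y in Iic 0, ρ₀ y) + ∫ y in (0 : ℝ)..x, ρ₀ y := by
  rw [← intervalIntegral.integral_Iic_sub_Iic h.integrable.integrableOn h.integrable.integrableOn]
  ring

theorem hasDerivAt_integral_Iic (h : InitialData δ ρ₀ u₀ Cρ Cu) (x : ℝ) :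
    HasDerivAt (fun x => ∫ y in Iic x, ρ₀ y) (ρ₀ x) x := by
  rw [funext h.integral_Iic_eq]
  exact (h.contDiff_ρ.continuous.integral_hasStrictDerivAt 0 x).hasDerivAt.const_add _

theorem continuous_integral_Iic (h : InitialData δ ρ₀ u₀ Cρ Cu) :
    Continuous fun x => ∫ y in Iic x, ρ₀ y :=
  continuous_iff_continuousAt.2 fun x => (h.hasDerivAt_integral_Iic x).continuousAt

theorem contDiff_integral_Iic (h : InitialData δ ρ₀ u₀ Cρ Cu) :
    ContDiff ℝ 1 fun x => ∫ y in Iic x, ρ₀ y := by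
  rw [contDiff_one_iff_deriv]
  refine ⟨fun x => (h.hasDerivAt_integral_Iic x).differentiableAt, ?_⟩
  rw [funext fun x => (h.hasDerivAt_integral_Iic x).deriv]
  exact h.contDiff_ρ.continuous

theorem abs_integral_Iic_le (h : InitialData δ ρ₀ u₀ Cρ Cu) (x : ℝ) :
    |∫ y in Iic x, ρ₀ y| ≤ ∫ y, ρ₀ y := by
  have hpos : 0 ≤ᵐ[volume] ρ₀ := Eventually.of_forall fun x => (h.pos x).le
  rw [abs_of_nonneg (setIntegral_nonneg measurableSet_Iic fun x _ => (h.pos x).le)]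
  exact setIntegral_le_integral h.integrable hpos

theorem abs_u_le (h : InitialData δ ρ₀ u₀ Cρ Cu) (x : ℝ) :
    |u₀ x| ≤ (|u₀ 0| + Cu) * (1 + |x|) := by
  have hCu : 0 ≤ Cu := (abs_nonneg _).trans (h.deriv_u_le 0)
  have h1 := Convex.norm_image_sub_le_of_norm_hasDerivWithin_le (s := univ) (C := Cu)
    (fun z _ => (h.hasDerivAt_u z).hasDerivWithinAt) (fun z _ => h.deriv_u_le z) convex_univ
    (mem_univ 0) (mem_univ x)
  rw [Real.norm_eq_abs, Real.norm_eq_abs, sub_zero] at h1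
  have h2 := abs_sub_abs_le_abs_sub (u₀ x) (u₀ 0)
  nlinarith [mul_nonneg (abs_nonneg (u₀ 0)) (abs_nonneg x)]

theorem integrable_mul (h : InitialData δ ρ₀ u₀ Cρ Cu) {k : ℝ → ℝ} {A : ℝ} (hk : Continuous k)
    (hA : ∀ x, |k x| ≤ A * (1 + |x|)) : Integrable fun x => k x * ρ₀ x :=
  integrable_mul_of_decay h.delta_pos h.contDiff_ρ.continuous hk h.decay hA

theorem integrable_cumul_mul (h : InitialData δ ρ₀ u₀ Cρ Cu) :
    Integrable fun x => (∫ y in Iic x, ρ₀ y) * ρ₀ x :=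
  h.integrable_mul h.continuous_integral_Iic (A := ∫ y, ρ₀ y) fun x =>
    (h.abs_integral_Iic_le x).trans
      (le_mul_of_one_le_right h.mass_pos.le (by linarith [abs_nonneg x]))

/-- `∫ F ρ₀ = M² / 2`, as `F ρ₀` is the derivative of `F² / 2`. -/
theorem integral_cumul_mul (h : InitialData δ ρ₀ u₀ Cρ Cu) :
    ∫ x, (∫ y in Iic x, ρ₀ y) * ρ₀ x = (∫ y, ρ₀ y) ^ 2 / 2 := by
  have hbot : Tendsto (fun x => ∫ y in Iic x, ρ₀ y) atBot (𝓝 0) := by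
    have h1 := intervalIntegral_tendsto_integral_Iic 0 h.integrable.integrableOn
      (tendsto_id (α := ℝ) (x := atBot))
    have h2 := h1.const_sub (∫ y in Iic 0, ρ₀ y)
    rw [sub_self] at h2
    refine h2.congr fun x => ?_
    rw [h.integral_Iic_eq x, intervalIntegral.integral_symm]
    simp
  have htop : Tendsto (fun x => ∫ y in Iic x, ρ₀ y) atTop (𝓝 (∫ y, ρ₀ y)) := by
    have h1 := intervalIntegral_tendsto_integral_Ioi 0 h.integrable.integrableOn
      (tendsto_id (α := ℝ) (x := atTop))
    have h2 := h1.const_add (∫ y in Iic 0, ρ₀ y)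
    rw [intervalIntegral.integral_Iic_add_Ioi h.integrable.integrableOn
      h.integrable.integrableOn] at h2
    exact h2.congr fun x => (h.integral_Iic_eq x).symm
  have hd : ∀ x, HasDerivAt (fun x => (∫ y in Iic x, ρ₀ y) ^ 2 / 2)
      ((∫ y in Iic x, ρ₀ y) * ρ₀ x) x := fun x =>
    (((h.hasDerivAt_integral_Iic x).pow 2).div_const 2).congr_deriv (by push_cast; ring)
  have key := integral_of_hasDerivAt_of_tendsto hd
    h.integrable_cumul_mul ((hbot.pow 2).div_const 2) ((htop.pow 2).div_const 2)
  rw [key]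
  ring

/-- A Lagrangian flow that satisfies Newton's equation, together with linear bounds on particle
paths and a positive lower bound on the Jacobian on compact time intervals, is the flow of a
solution: `u` is the particle velocity and `ρ = ρ₀ / w` along particle paths. -/
theorem exists_isSolution_of_isFlow (h : InitialData δ ρ₀ u₀ Cρ Cu) {T : ℝ} (hT : 0 < T)
    {I : Set ℝ} {X V A w w' : ℝ → ℝ → ℝ} (hfl : IsFlow I X V w) (hI : Ico 0 T ⊆ I)
    (hA : ∀ x t, HasDerivAt (V x) (A x t) t)
    (hNewton : ∀ x t, A x t + V x t + (∫ y, ρ₀ y) * X x t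
      = 2 * (∫ y in Iic x, ρ₀ y) - (∫ y, ρ₀ y) + ∫ y, X y t * ρ₀ y)
    (hX0 : ∀ x, X x 0 = x) (hV0 : ∀ x, V x 0 = u₀ x) (hw0 : ∀ x, w x 0 = 1)
    (hXb : ∀ S, ∃ K, 0 ≤ K ∧ ∀ x, ∀ t ∈ Icc 0 S, |X x t| ≤ K * (1 + |x|))
    (hVb : ∀ S, ∃ K, 0 ≤ K ∧ ∀ x, ∀ t ∈ Icc 0 S, |V x t| ≤ K * (1 + |x|))
    (hlow : ∀ S < T, ∃ c > 0, ∀ x, ∀ t ∈ Icc 0 S, c ≤ w x t)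
    (hVx : ∀ x t, HasDerivAt (fun x => V x t) (w' x t) x)
    (hwt : ∀ x t, HasDerivAt (w x) (w' x t) t) :
    ∃ ρ u, IsSolution δ ρ₀ u₀ T ρ u ∧
      (ContDiff ℝ 1 (fun p : ℝ × ℝ => w p.1 p.2) → IsClassicalSolution δ ρ₀ u₀ T ρ u) := by
  have hδ := h.delta_pos
  obtain ⟨Y, hXY, hYX, hYc⟩ := hfl.exists_inverse
  set M := ∫ y, ρ₀ y with hM
  set F : ℝ → ℝ := fun x => ∫ y in Iic x, ρ₀ y with hF
  set ρ : ℝ → ℝ → ℝ := fun z t => ρ₀ (Y z t) / w (Y z t) t with hρ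
  set u : ℝ → ℝ → ℝ := fun z t => V (Y z t) t with hu
  have hwY : ∀ z, ∀ t ∈ I, w (Y z t) t ≠ 0 := fun z t ht => (hfl.w_pos _ t ht).ne'
  have hsubI : (univ ×ˢ Ico 0 T : Set (ℝ × ℝ)) ⊆ univ ×ˢ I := prod_mono le_rfl hI
  have hYt : ContDiffOn ℝ 1 (fun p : ℝ × ℝ => (Y p.1 p.2, p.2)) (univ ×ˢ I) :=
    hYc.prodMk contDiffOn_snd
  have huC : ContDiffOn ℝ 1 (fun p : ℝ × ℝ => u p.1 p.2) (univ ×ˢ I) :=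
    hfl.contDiff_V.comp_contDiffOn hYt
  have hρc : ContinuousOn (fun p : ℝ × ℝ => ρ p.1 p.2) (univ ×ˢ I) :=
    (h.contDiff_ρ.continuous.comp_continuousOn hYc.continuousOn).div
      (hfl.continuous_w.comp_continuousOn hYt.continuousOn) fun p hp => hwY p.1 p.2 hp.2
  have hρX : ∀ x, ∀ t ∈ I, ρ₀ x = ρ (X x t) t * w x t := by
    intro x t ht
    simp only [hρ, hYX t ht]
    rw [div_mul_cancel₀ _ (hfl.w_pos x t ht).ne']
  have huX : ∀ x, ∀ t ∈ I, u (X x t) t = V x t := fun x t ht => by simp only [hu, hYX t ht]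
  have hslice : ∀ t ∈ I, Continuous fun z => ρ z t := fun t ht => by
    rw [← continuousOn_univ]
    exact hρc.comp (f := fun x : ℝ => (x, t)) (by fun_prop) fun x _ => ⟨mem_univ _, ht⟩
  -- `ρ = ρ₀ / w` decays like `ρ₀`, because `w` is bounded below and `|X| ≤ K (1 + |x|)`.
  have hdecay : ∀ S < T, ∃ C, ∀ t ∈ Icc 0 S, ∀ z, |ρ z t| ≤ C * (1 + |z|) ^ (-(2 + δ)) := by
    intro S hS
    obtain ⟨c, hc, hcw⟩ := hlow S hS
    obtain ⟨K, hK, hKX⟩ := hXb S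
    refine ⟨Cρ / c * (1 + K) ^ (2 + δ), fun t ht z => ?_⟩
    have htI : t ∈ I := hI ⟨ht.1, ht.2.trans_lt hS⟩
    have hz : |z| ≤ K * (1 + |Y z t|) := by
      have := hKX (Y z t) t ht
      rwa [hXY t htI] at this
    have hz' : 1 + |z| ≤ (1 + K) * (1 + |Y z t|) := by linarith [abs_nonneg (Y z t)]
    have hpow : (1 + |Y z t|) ^ (-(2 + δ)) ≤ (1 + K) ^ (2 + δ) * (1 + |z|) ^ (-(2 + δ)) := by
      have h1 := Real.rpow_le_rpow_of_nonpos (by positivity) hz'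
        (show -(2 + δ) ≤ 0 by linarith)
      rw [Real.mul_rpow (by positivity) (by positivity)] at h1
      have h2 : (1 + K) ^ (2 + δ) * (1 + K) ^ (-(2 + δ)) = 1 := by
        rw [← Real.rpow_add (by positivity), add_neg_cancel, Real.rpow_zero]
      calc (1 + |Y z t|) ^ (-(2 + δ))
          = (1 + K) ^ (2 + δ) * ((1 + K) ^ (-(2 + δ)) * (1 + |Y z t|) ^ (-(2 + δ))) := by
            rw [← mul_assoc, h2, one_mul]
        _ ≤ _ := mul_le_mul_of_nonneg_left h1 (by positivity)
    have hCρ : 0 ≤ Cρ := by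
      have := (abs_nonneg _).trans (h.decay 0)
      simpa using this
    have hwc := hcw (Y z t) t ht
    calc |ρ z t| = |ρ₀ (Y z t)| / w (Y z t) t := by
          simp only [hρ]
          rw [abs_div, abs_of_pos (hc.trans_le hwc)]
      _ ≤ |ρ₀ (Y z t)| / c := div_le_div_of_nonneg_left (abs_nonneg _) hc hwc
      _ ≤ (Cρ * ((1 + K) ^ (2 + δ) * (1 + |z|) ^ (-(2 + δ)))) / c := by
          gcongr
          exact (h.decay _).trans (mul_le_mul_of_nonneg_left hpow hCρ)
      _ = _ := by ring
  -- The lower bound on the Jacobian makes `Y` grow linearly, hence so does `u = V(Y, t)`.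
  have hgrowth : ∀ t ∈ Ico 0 T, ∃ B, ∀ z, |u z t| ≤ B * (1 + |z|) := by
    intro t ht
    have htt : t ∈ Icc 0 t := right_mem_Icc.2 ht.1
    obtain ⟨c, hc, hcw⟩ := hlow t ht.2
    obtain ⟨K, hK, hKV⟩ := hVb t
    refine ⟨K * (1 + (1 + |X 0 t|) / c), fun z => ?_⟩
    have h1 := mul_abs_le_of_deriv_ge (fun x => hfl.hasDerivAt_space x t)
      (fun x => hcw x t htt) (Y z t)
    rw [hXY t (hI ht)] at h1
    have h2 : |Y z t| ≤ (|z| + |X 0 t|) / c := by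
      rw [le_div_iff₀ hc, mul_comm]
      exact h1
    refine (hKV _ t htt).trans ?_
    rw [mul_assoc]
    refine mul_le_mul_of_nonneg_left ?_ hK
    have h3 : (|z| + |X 0 t|) / c ≤ (1 + |X 0 t|) / c * (1 + |z|) := by
      rw [div_mul_eq_mul_div]
      gcongr
      nlinarith [mul_nonneg (abs_nonneg (X 0 t)) (abs_nonneg z)]
    have h4 : 0 ≤ (1 + |X 0 t|) / c := by positivity
    nlinarith [abs_nonneg z]
  have hfar : FarField δ T ρ u := by
    have hpow : ∀ t ∈ Ico 0 T, ∀ i : ℕ, i ≤ 2 →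
        Tendsto (fun z => ρ z t * |u z t| ^ i) (cocompact ℝ) (𝓝 0) := by
      intro t ht i hi
      obtain ⟨C, hC⟩ := hdecay t ht.2
      obtain ⟨B, hB⟩ := hgrowth t ht
      have hlim := (tendsto_one_add_abs_rpow_neg (s := 2 + δ - i) (by
        have : (i : ℝ) ≤ 2 := by exact_mod_cast hi
        linarith)).const_mul (C * B ^ i)
      rw [mul_zero] at hlim
      refine squeeze_zero_norm (fun z => ?_) hlim
      have hz : (0 : ℝ) < 1 + |z| := by positivity
      have h1 : (1 + |z|) ^ (-(2 + δ - i)) = (1 + |z|) ^ i * (1 + |z|) ^ (-(2 + δ)) := by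
        rw [← Real.rpow_natCast, ← Real.rpow_add hz]
        ring_nf
      rw [norm_mul, norm_pow, Real.norm_eq_abs, Real.norm_eq_abs, abs_abs, h1]
      calc |ρ z t| * |u z t| ^ i
          ≤ (C * (1 + |z|) ^ (-(2 + δ))) * (B * (1 + |z|)) ^ i :=
            mul_le_mul (hC t (right_mem_Icc.2 ht.1) z)
              (pow_le_pow_left₀ (abs_nonneg _) (hB z) i) (by positivity)
              ((abs_nonneg _).trans (hC t (right_mem_Icc.2 ht.1) z))
        _ = _ := by rw [mul_pow]; ring
    refine ⟨fun t ht => by simpa using hpow t ht 1 one_le_two, fun t ht => hpow t ht 2 le_rfl,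
      fun S hS => ?_⟩
    obtain ⟨C, hC⟩ := hdecay S hS.2
    have hC0 : 0 ≤ C := by
      have := (abs_nonneg _).trans (hC 0 (left_mem_Icc.2 hS.1) 0)
      simpa using this
    refine ⟨C, fun t ht z => ?_⟩
    have hz : (0 : ℝ) < 1 + |z| := by positivity
    calc |z| ^ (2 + δ) * |ρ z t|
        ≤ (1 + |z|) ^ (2 + δ) * (C * (1 + |z|) ^ (-(2 + δ))) :=
          mul_le_mul (Real.rpow_le_rpow (abs_nonneg z) (by linarith) (by linarith)) (hC t ht z)
            (abs_nonneg _) (by positivity)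
      _ = C * ((1 + |z|) ^ (2 + δ) * (1 + |z|) ^ (-(2 + δ))) := by ring
      _ = C := by rw [← Real.rpow_add hz, add_neg_cancel, Real.rpow_zero, mul_one]
  have h0I : (0 : ℝ) ∈ I := hI ⟨le_rfl, hT⟩
  have hinit_ρ : ∀ x, ρ x 0 = ρ₀ x := fun x => by
    have h1 := hρX x 0 h0I
    rw [hX0, hw0, mul_one] at h1
    exact h1.symm
  have hinit_u : ∀ x, u x 0 = u₀ x := fun x => by
    have h1 := huX x 0 h0I
    rwa [hX0, hV0] at h1
  have hY0 : ∀ x, Y x 0 = x := fun x => by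
    have h1 := hYX 0 h0I x
    rwa [hX0] at h1
  -- The force along a particle path, by a change of variables.
  have hforce : ∀ t ∈ Ico 0 T, ∀ z, -force ρ z t
      = 2 * F (Y z t) - M - M * z + ∫ y, X y t * ρ₀ y := by
    intro t ht z
    have htI := hI ht
    obtain ⟨C, hC⟩ := hdecay t ht.2
    have hCt := hC t (right_mem_Icc.2 ht.1)
    have hint := integrable_of_decay hδ (hslice t htI) hCt
    have hint' := integrable_mul_of_decay (A := 1) (k := fun y => y) hδ (hslice t htI)
      continuous_id hCt (fun x => by linarith)
    have himage : (fun x => X x t) '' Iic (Y z t) = Iic z := by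
      ext z'
      constructor
      · rintro ⟨x, hx, rfl⟩
        have := (hfl.strictMono t htI).monotone (mem_Iic.1 hx)
        simp only [hXY t htI] at this
        exact this
      · intro hz'
        refine ⟨Y z' t, ?_, hXY t htI z'⟩
        rw [mem_Iic, ← (hfl.strictMono t htI).le_iff_le]
        simpa only [hXY t htI, mem_Iic] using hz'
    have h1 : ∫ y in Iic z, ρ y t = F (Y z t) := by
      rw [← himage]
      exact setIntegral_image_of_strictMono (fun x => hfl.hasDerivAt_space x t)
        (fun x => hfl.w_pos x t htI) (hfl.strictMono t htI) (fun x => hρX x t htI)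
        measurableSet_Iic
    have h2 : ∫ y, ρ y t = M :=
      setIntegral_univ_of_surjective (fun x => hfl.hasDerivAt_space x t)
        (fun x => hfl.w_pos x t htI) (hfl.strictMono t htI) (hfl.surjective t htI)
        (fun x => hρX x t htI)
    have h3 : ∫ y, y * ρ y t = ∫ y, X y t * ρ₀ y :=
      setIntegral_univ_of_surjective (fun x => hfl.hasDerivAt_space x t)
        (fun x => hfl.w_pos x t htI) (hfl.strictMono t htI) (hfl.surjective t htI)
        (fun x => by rw [hρX x t htI]; ring)
    rw [force, integral_deriv_W_mul hint hint', h1, h2, h3]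
    ring
  have hIoo : ∀ t ∈ Ioo 0 T, t ∈ I := fun t ht => hI (Ioo_subset_Ico_self ht)
  have hud : ∀ z, ∀ t ∈ I, HasFDerivAt (fun p : ℝ × ℝ => u p.1 p.2)
      (fderiv ℝ (fun p : ℝ × ℝ => u p.1 p.2) (z, t)) (z, t) := fun z t ht =>
    ((huC.contDiffAt (prod_mem_nhds univ_mem (hfl.isOpen.mem_nhds ht))).differentiableAt
      one_ne_zero).hasFDerivAt
  have hsplit : ∀ (L : ℝ × ℝ →L[ℝ] ℝ) (v : ℝ), L (v, 1) = v * L (1, 0) + L (0, 1) := by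
    intro L v
    have : ((v, 1) : ℝ × ℝ) = v • (1, 0) + (0, 1) := by simp
    rw [this, map_add, map_smul, smul_eq_mul]
  have hmom : MomentumEq T ρ u := by
    intro z t ht
    have htI := hIoo t ht
    set L := fderiv ℝ (fun p : ℝ × ℝ => u p.1 p.2) (z, t) with hL
    have hd := hud z t htI
    have hd' : HasFDerivAt (fun p : ℝ × ℝ => u p.1 p.2) L (X (Y z t) t, t) := by
      rw [hXY t htI]
      exact hd
    have hc := hasDerivAt_along_curve hd' (hfl.hasDerivAt_time (Y z t) t)
    have hcA : HasDerivAt (fun s => u (X (Y z t) s) s) (A (Y z t) t) t := by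
      refine (hA (Y z t) t).congr_of_eventuallyEq ?_
      filter_upwards [hfl.isOpen.mem_nhds htI] with s hs
      exact huX _ s hs
    have h1 := hc.unique hcA
    rw [hsplit] at h1
    have h2 := hNewton (Y z t) t
    rw [hXY t htI] at h2
    rw [(hasDerivAt_space_slice hd).deriv, (hasDerivAt_time_slice hd).deriv,
      hforce t (Ioo_subset_Ico_self ht) z]
    linear_combination h1 + h2
  refine ⟨ρ, u, ⟨hρc.mono hsubI, huC.mono hsubI, hinit_ρ, hinit_u, ?_, hmom, hfar⟩, fun hwC =>
    ⟨?_, huC.mono hsubI, hinit_ρ, hinit_u, ?_, hmom, hfar⟩⟩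
  · -- The conservation law, for the potential `F (Y z t)`.
    intro a b t ht
    have hsub : Icc 0 t ⊆ Ico 0 T := fun s hs => ⟨hs.1, hs.2.trans_lt ht.2⟩
    have hspace : (∫ x in a..b, ρ x t) = F (Y b t) - F (Y a t) := by
      refine intervalIntegral.integral_eq_sub_of_hasDerivAt (f := fun z => F (Y z t))
        (f' := fun z => ρ z t) (fun z _ => ?_) ((hslice t (hI ht)).intervalIntegrable _ _)
      have hz := (hfl.hasDerivAt_inverse hXY hYX hYc (z := z) (hI ht)).1
      exact ((h.hasDerivAt_integral_Iic (Y z t)).comp z hz).congr_deriv (mul_one_div _ _)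
    have hflux : ∀ z, IntervalIntegrable (fun s => ρ z s * u z s) volume 0 t := fun z => by
      refine ContinuousOn.intervalIntegrable ?_
      rw [uIcc_of_le ht.1]
      exact ((continuousOn_time_slice (hρc.mono hsubI) z).mul
        (continuousOn_time_slice (huC.continuousOn.mono hsubI) z)).mono hsub
    have htime : ∀ z, (∫ s in (0 : ℝ)..t, ρ z s * u z s) = F z - F (Y z t) := by
      intro z
      have := intervalIntegral.integral_eq_sub_of_hasDerivAt (f := fun s => -F (Y z s))
        (f' := fun s => ρ z s * u z s) (a := 0) (b := t) (fun s hs => ?_) (hflux z)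
      · rw [this, hY0]
        ring
      · rw [uIcc_of_le ht.1] at hs
        have hs' := (hfl.hasDerivAt_inverse hXY hYX hYc (z := z) (hI (hsub hs))).2
        exact ((h.hasDerivAt_integral_Iic (Y z s)).comp s hs').neg.congr_deriv
          (by simp only [hρ, hu]; ring)
    have hinit : (∫ x in a..b, ρ₀ x) = F b - F a :=
      (intervalIntegral.integral_Iic_sub_Iic h.integrable.integrableOn
        h.integrable.integrableOn).symm
    rw [hspace, hinit, intervalIntegral.integral_sub (hflux a) (hflux b), htime, htime]
    ring
  · exact (((h.contDiff_ρ.comp_contDiffOn hYc).div (hwC.comp_contDiffOn hYt)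
      fun p hp => hwY p.1 p.2 hp.2)).mono hsubI
  · intro z t ht
    have htI := hIoo t ht
    have hρC : ContDiffOn ℝ 1 (fun p : ℝ × ℝ => ρ p.1 p.2) (univ ×ˢ I) :=
      (h.contDiff_ρ.comp_contDiffOn hYc).div (hwC.comp_contDiffOn hYt)
        fun p hp => hwY p.1 p.2 hp.2
    have hρd := ((hρC.contDiffAt (prod_mem_nhds univ_mem (hfl.isOpen.mem_nhds htI)) :
      ContDiffAt ℝ 1 _ (z, t)).differentiableAt one_ne_zero).hasFDerivAt
    have hd := hud z t htI
    set R := fderiv ℝ (fun p : ℝ × ℝ => ρ p.1 p.2) (z, t) with hR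
    set L := fderiv ℝ (fun p : ℝ × ℝ => u p.1 p.2) (z, t) with hL
    set x := Y z t with hx
    have hz : X x t = z := hXY t htI z
    -- Differentiate `ρ (X, t) w = ρ₀` in time and `u (X, t) = V` in space.
    have h1 : R (V x t, 1) * w x t + ρ z t * w' x t = 0 := by
      have hc := (hasDerivAt_along_curve (X := X x) (by rw [hz]; exact hρd)
        (hfl.hasDerivAt_time x t)).mul (hwt x t)
      have hcst : HasDerivAt (fun s => ρ (X x s) s * w x s) 0 t := by
        refine (hasDerivAt_const t (ρ₀ x)).congr_of_eventuallyEq ?_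
        filter_upwards [hfl.isOpen.mem_nhds htI] with s hs
        exact (hρX x s hs).symm
      have := hc.unique hcst
      rwa [hz] at this
    have h2 : L (1, 0) * w x t = w' x t := by
      have hc := HasDerivAt.comp x (h₂ := fun y => u y t) (by
        rw [hz]; exact hasDerivAt_space_slice hd) (hfl.hasDerivAt_space x t)
      have heq : (fun y => u y t) ∘ (fun x => X x t) = fun x => V x t :=
        funext fun y => huX y t htI
      rw [heq] at hc
      exact hc.unique (hVx x t)
    have huz : u z t = V x t := rfl
    rw [hsplit, ← h2] at h1
    have hprod : HasDerivAt (fun y => ρ y t * u y t) (R (1, 0) * u z t + ρ z t * L (1, 0)) z :=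
      (hasDerivAt_space_slice hρd).mul (hasDerivAt_space_slice hd)
    rw [(hasDerivAt_time_slice hρd).deriv, hprod.deriv, huz]
    refine mul_left_cancel₀ (hwY z t htI) ?_
    linear_combination h1

end InitialData

/-! ### Existence of solutions -/

namespace InitialData

variable {δ Cρ Cu : ℝ} {ρ₀ u₀ : ℝ → ℝ}

theorem le_const (h : InitialData δ ρ₀ u₀ Cρ Cu) (x : ℝ) : ρ₀ x ≤ Cρ := by
  have hCρ : 0 ≤ Cρ := by simpa using (abs_nonneg _).trans (h.decay 0)
  have h1 : (1 + |x|) ^ (-(2 + δ)) ≤ 1 := Real.rpow_le_one_of_one_le_of_nonpos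
    (by linarith [abs_nonneg x]) (by linarith [h.delta_pos])
  exact (le_abs_self _).trans ((h.decay x).trans (mul_le_of_le_one_right hCρ h1))

theorem integral_lagrangian_mul (h : InitialData δ ρ₀ u₀ Cρ Cu) (α₀ α₁ α₂ α₃ : ℝ → ℝ) (t : ℝ) :
    ∫ y, lagrangian u₀ (fun x => ∫ y in Iic x, ρ₀ y) α₀ α₁ α₂ α₃ y t * ρ₀ y
      = α₀ t * (∫ y, ρ₀ y) + α₁ t * (∫ y, y * ρ₀ y) + α₂ t * (∫ y, u₀ y * ρ₀ y)
        + α₃ t * ((∫ y, ρ₀ y) ^ 2 / 2) := by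
  have i₀ := h.integrable.const_mul (α₀ t)
  have i₁ := (h.integrable_mul (k := fun y => y) (A := 1) continuous_id
    (fun x => by linarith)).const_mul (α₁ t)
  have i₂ := (h.integrable_mul h.contDiff_u.continuous h.abs_u_le).const_mul (α₂ t)
  have i₃ := h.integrable_cumul_mul.const_mul (α₃ t)
  have heq : ∀ y, lagrangian u₀ (fun x => ∫ y in Iic x, ρ₀ y) α₀ α₁ α₂ α₃ y t * ρ₀ y
      = α₀ t * ρ₀ y + α₁ t * (y * ρ₀ y) + α₂ t * (u₀ y * ρ₀ y)
        + α₃ t * ((∫ z in Iic y, ρ₀ z) * ρ₀ y) := fun y => by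
    unfold lagrangian
    ring
  simp_rw [heq]
  have i₀₁ : Integrable fun y => α₀ t * ρ₀ y + α₁ t * (y * ρ₀ y) := i₀.add i₁
  have i₀₂ : Integrable fun y => α₀ t * ρ₀ y + α₁ t * (y * ρ₀ y) + α₂ t * (u₀ y * ρ₀ y) :=
    i₀₁.add i₂
  rw [integral_add i₀₂ i₃, integral_add i₀₁ i₂, integral_add i₀ i₁, integral_const_mul,
    integral_const_mul, integral_const_mul, integral_const_mul, h.integral_cumul_mul]

variable {φ φ' : ℝ → ℝ}

/-- As long as the Jacobian is positive, it is bounded below on compact time intervals. -/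
theorem exists_stretch_lower_bound (h : InitialData δ ρ₀ u₀ Cρ Cu)
    (hφ : IsDampedOscillator (∫ x, ρ₀ x) φ φ') (hφ0 : φ 0 = 0) (hφ0' : φ' 0 = 1) {T : ℝ}
    (hpos : ∀ x, ∀ t ∈ Ico 0 T, 0 < stretch (∫ x, ρ₀ x) φ φ' (ρ₀ x) (deriv u₀ x) t) {S : ℝ}
    (hS : S < T) :
    ∃ c > 0, ∀ x, ∀ t ∈ Icc 0 S, c ≤ stretch (∫ x, ρ₀ x) φ φ' (ρ₀ x) (deriv u₀ x) t := by
  have hM := h.mass_pos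
  set M := ∫ x, ρ₀ x with hMdef
  have hφc := hφ.continuous
  have hφc' := hφ.continuous'
  have heq : ∀ x t, stretch M φ φ' (ρ₀ x) (deriv u₀ x) t
      = (φ t + φ' t) + deriv u₀ x * φ t + 2 * ρ₀ x * ((1 - (φ t + φ' t)) / M) := fun x t => by
    unfold stretch
    field_simp
    ring
  simp_rw [heq] at hpos ⊢
  refine exists_pos_lower_bound (φ₁ := fun t => φ t + φ' t) (φ₂ := φ)
    (φ₃ := fun t => (1 - (φ t + φ' t)) / M) (φ₁' := fun t => -(M * φ t)) (φ₂' := φ') hS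
    h.contDiff_ρ.continuous h.continuous_deriv_u h.pos h.tendsto_zero h.deriv_u_le
    (by fun_prop) hφc.continuousOn (by fun_prop)
    (fun t _ => ((hφ.hasDerivAt t).add (hφ.hasDerivAt' t)).congr_deriv (by ring))
    (fun t _ => hφ.hasDerivAt t) (fun t _ hW => ?_) (by simp [hφ0, hφ0']) hφ0 hpos
  have hQ := hφ.quadratic_form_eq t
  rw [hφ0, hφ0'] at hQ
  have : φ' t ^ 2 + φ t * φ' t + M * φ t ^ 2 = 0 := by linear_combination hW
  rw [this] at hQ
  norm_num at hQ

/-- Near time `0` the Jacobian is uniformly close to `1`, also for negative times. -/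
theorem exists_half_le_stretch (h : InitialData δ ρ₀ u₀ Cρ Cu)
    (hφ : IsDampedOscillator (∫ x, ρ₀ x) φ φ') (hφ0 : φ 0 = 0) (hφ0' : φ' 0 = 1) :
    ∃ ε > 0, ∀ t, |t| < ε → ∀ x,
      1 / 2 ≤ stretch (∫ x, ρ₀ x) φ φ' (ρ₀ x) (deriv u₀ x) t := by
  have hM := h.mass_pos
  set M := ∫ x, ρ₀ x with hMdef
  have hφc := hφ.continuous
  have hφc' := hφ.continuous'
  have hCρ : 0 ≤ Cρ := (h.pos 0).le.trans (h.le_const 0)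
  have hlim : Tendsto (fun t => |φ t + φ' t - 1| * (1 + 2 * Cρ / M) + Cu * |φ t|) (𝓝 0) (𝓝 0) := by
    have : Continuous fun t => |φ t + φ' t - 1| * (1 + 2 * Cρ / M) + Cu * |φ t| := by fun_prop
    simpa [hφ0, hφ0'] using this.tendsto 0
  obtain ⟨ε, hε, hball⟩ := Metric.eventually_nhds_iff.1
    (hlim.eventually_lt_const (by norm_num : (0 : ℝ) < 1 / 2))
  refine ⟨ε, hε, fun t ht x => ?_⟩
  have hb := hball (y := t) (by simpa using ht)
  have heq : stretch M φ φ' (ρ₀ x) (deriv u₀ x) t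
      = 1 + ((φ t + φ' t - 1) - (φ t + φ' t - 1) * (2 * ρ₀ x / M) + deriv u₀ x * φ t) := by
    unfold stretch
    ring
  have h1 : |(φ t + φ' t - 1) * (2 * ρ₀ x / M)| ≤ |φ t + φ' t - 1| * (2 * Cρ / M) := by
    rw [abs_mul, abs_of_pos (div_pos (mul_pos two_pos (h.pos x)) hM)]
    have := h.le_const x
    gcongr
  have h2 : |deriv u₀ x * φ t| ≤ Cu * |φ t| := by
    rw [abs_mul]
    exact mul_le_mul_of_nonneg_right (h.deriv_u_le x) (abs_nonneg _)
  rw [heq]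
  have h3 := abs_le.1 h1
  have h4 := abs_le.1 h2
  have h5 := neg_abs_le (φ t + φ' t - 1)
  linarith [h3.2, h4.1]

/-- A solution exists on `[0, T)` if the Jacobian stays positive there. Particle paths are the
explicit solutions of `X'' + X' + M X = 2 F - M + p` with `p t = p₀ + q₀ (1 - e^{-t})` the first
moment of the density; `p / M` is a particular solution of the equation with right-hand side `p`. -/
theorem exists_isSolution (h : InitialData δ ρ₀ u₀ Cρ Cu)
    (hφ : IsDampedOscillator (∫ x, ρ₀ x) φ φ') (hφ0 : φ 0 = 0) (hφ0' : φ' 0 = 1) {T : ℝ}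
    (hT : 0 < T)
    (hpos : ∀ x, ∀ t ∈ Ico 0 T, 0 < stretch (∫ x, ρ₀ x) φ φ' (ρ₀ x) (deriv u₀ x) t) :
    ∃ ρ u, IsSolution δ ρ₀ u₀ T ρ u ∧ (ContDiff ℝ 2 u₀ → IsClassicalSolution δ ρ₀ u₀ T ρ u) := by
  have hlow := fun S (hS : S < T) => h.exists_stretch_lower_bound hφ hφ0 hφ0' hpos hS
  obtain ⟨ε, hε, hhalf⟩ := h.exists_half_le_stretch hφ hφ0 hφ0'
  have hM := h.mass_pos
  have hintL := h.integral_lagrangian_mul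
  have hFb := h.abs_integral_Iic_le
  set M := ∫ x, ρ₀ x with hMdef
  set p₀ := ∫ y, y * ρ₀ y with hp₀
  set q₀ := ∫ y, u₀ y * ρ₀ y with hq₀
  set F : ℝ → ℝ := fun x => ∫ y in Iic x, ρ₀ y with hF
  have hφc := hφ.continuous
  have hφc' := hφ.continuous'
  have hφC : ContDiff ℝ 1 φ := contDiff_one_iff_deriv.2
    ⟨fun t => (hφ.hasDerivAt t).differentiableAt, by
      rwa [funext fun t => (hφ.hasDerivAt t).deriv]⟩
  have hφC' : ContDiff ℝ 1 φ' := contDiff_one_iff_deriv.2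
    ⟨fun t => (hφ.hasDerivAt' t).differentiableAt, by
      rw [funext fun t => (hφ.hasDerivAt' t).deriv]; fun_prop⟩
  have hexp : ∀ t, HasDerivAt (fun t => Real.exp (-t)) (-Real.exp (-t)) t := fun t => by
    simpa using (hasDerivAt_neg t).exp
  have hsum : ∀ t, HasDerivAt (fun t => φ t + φ' t) (-(M * φ t)) t := fun t =>
    ((hφ.hasDerivAt t).add (hφ.hasDerivAt' t)).congr_deriv (by ring)
  -- Coefficients `a` of the flow map, `b` of its velocity, `c` of its acceleration, with `a₂ = φ`
  -- and `b₂ = φ'`.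
  set a₀ : ℝ → ℝ := fun t => (p₀ + q₀ * (1 - Real.exp (-t))) / M - p₀ / M * (φ t + φ' t)
    - q₀ / M * φ t - (1 - (φ t + φ' t)) with ha₀
  set a₁ : ℝ → ℝ := fun t => φ t + φ' t with ha₁
  set a₃ : ℝ → ℝ := fun t => 2 * (1 - (φ t + φ' t)) / M with ha₃
  set b₀ : ℝ → ℝ := fun t => q₀ / M * Real.exp (-t) + p₀ * φ t - q₀ / M * φ' t - M * φ t with hb₀
  set b₁ : ℝ → ℝ := fun t => -(M * φ t) with hb₁
  set b₃ : ℝ → ℝ := fun t => 2 * φ t with hb₃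
  set c₀ : ℝ → ℝ := fun t => -(q₀ / M * Real.exp (-t)) + p₀ * φ' t
    + q₀ / M * (φ' t + M * φ t) - M * φ' t with hc₀
  set c₁ : ℝ → ℝ := fun t => -(M * φ' t) with hc₁
  set c₂ : ℝ → ℝ := fun t => -φ' t - M * φ t with hc₂
  set c₃ : ℝ → ℝ := fun t => 2 * φ' t with hc₃
  set w : ℝ → ℝ → ℝ := fun x t => a₁ t + deriv u₀ x * φ t + ρ₀ x * a₃ t with hw
  have hws : ∀ x t, w x t = stretch M φ φ' (ρ₀ x) (deriv u₀ x) t := fun x t => by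
    simp only [hw, ha₁, ha₃]
    unfold stretch
    field_simp
    ring
  simp_rw [← hws] at hlow hhalf
  have hXx : ∀ x t, HasDerivAt (fun x => lagrangian u₀ F a₀ a₁ φ a₃ x t) (w x t) x := fun x t =>
    hasDerivAt_lagrangian_space (h.hasDerivAt_u x) (h.hasDerivAt_integral_Iic x) t
  have hVx : ∀ x t, HasDerivAt (fun x => lagrangian u₀ F b₀ b₁ φ' b₃ x t)
      (b₁ t + deriv u₀ x * φ' t + ρ₀ x * b₃ t) x := fun x t =>
    hasDerivAt_lagrangian_space (h.hasDerivAt_u x) (h.hasDerivAt_integral_Iic x) t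
  have ha₃' : ∀ t, HasDerivAt a₃ (b₃ t) t := fun t =>
    ((((hsum t).const_sub 1).const_mul 2).div_const M).congr_deriv (by
      simp only [hb₃]; field_simp)
  have hXt : ∀ x t, HasDerivAt (lagrangian u₀ F a₀ a₁ φ a₃ x)
      (lagrangian u₀ F b₀ b₁ φ' b₃ x t) t := fun x t =>
    hasDerivAt_lagrangian_time
      (((((((hexp t).const_sub 1).const_mul q₀).const_add p₀).div_const M).sub
        ((hsum t).const_mul (p₀ / M))).sub ((hφ.hasDerivAt t).const_mul (q₀ / M))
          |>.sub ((hsum t).const_sub 1) |>.congr_deriv (by simp only [hb₀]; field_simp; ring))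
      (hsum t) (hφ.hasDerivAt t) (ha₃' t) x
  have hVt : ∀ x t, HasDerivAt (lagrangian u₀ F b₀ b₁ φ' b₃ x)
      (lagrangian u₀ F c₀ c₁ c₂ c₃ x t) t := fun x t =>
    hasDerivAt_lagrangian_time
      ((((hexp t).const_mul (q₀ / M)).add ((hφ.hasDerivAt t).const_mul p₀)).sub
        ((hφ.hasDerivAt' t).const_mul (q₀ / M)) |>.sub ((hφ.hasDerivAt t).const_mul M)
          |>.congr_deriv (by simp only [hc₀]; ring))
      (((hφ.hasDerivAt t).const_mul M).neg) (hφ.hasDerivAt' t)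
      ((hφ.hasDerivAt t).const_mul 2) x
  have hmono : ∀ t ∈ Ioo (-ε) T, ∃ c > 0, ∀ x, c ≤ w x t := by
    intro t ht
    rcases lt_or_ge t 0 with h0 | h0
    · exact ⟨1 / 2, by norm_num, hhalf t (by rw [abs_of_neg h0]; linarith [ht.1])⟩
    · obtain ⟨c, hc, hcw⟩ := hlow t ht.2
      exact ⟨c, hc, fun x => hcw x t ⟨h0, le_rfl⟩⟩
  have hflow : IsFlow (Ioo (-ε) T) (lagrangian u₀ F a₀ a₁ φ a₃)
      (lagrangian u₀ F b₀ b₁ φ' b₃) w := by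
    refine ⟨isOpen_Ioo, ?_, ?_, ?_, hXx, hXt, fun x t ht => ?_, fun t ht => ?_, fun t ht => ?_⟩
    · exact contDiff_lagrangian h.contDiff_u h.contDiff_integral_Iic (by fun_prop) (by fun_prop)
        hφC (by fun_prop)
    · exact contDiff_lagrangian h.contDiff_u h.contDiff_integral_Iic (by fun_prop) (by fun_prop)
        hφC' (by fun_prop)
    · have h1 := h.continuous_deriv_u
      have h2 := h.contDiff_ρ.continuous
      simp only [hw, ha₁, ha₃]
      fun_prop
    · obtain ⟨c, hc, hcw⟩ := hmono t ht
      exact hc.trans_le (hcw x)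
    · obtain ⟨c, hc, hcw⟩ := hmono t ht
      exact (strictMono_and_surjective_of_deriv_ge hc (fun x => hXx x t) hcw).1
    · obtain ⟨c, hc, hcw⟩ := hmono t ht
      exact (strictMono_and_surjective_of_deriv_ge hc (fun x => hXx x t) hcw).2
  obtain ⟨ρ, u, hsol, hcl⟩ := h.exists_isSolution_of_isFlow hT hflow
    (fun t ht => ⟨by linarith [ht.1], ht.2⟩) hVt (fun x t => by
      rw [hintL]
      simp only [lagrangian, ha₀, ha₁, ha₃, hb₀, hb₁, hb₃, hc₀, hc₁, hc₂, hc₃]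
      field_simp
      ring)
    (fun x => by simp [lagrangian, ha₀, ha₁, ha₃, hφ0, hφ0'])
    (fun x => by simp [lagrangian, hb₀, hb₁, hb₃, hφ0, hφ0'])
    (fun x => by simp [hw, ha₁, ha₃, hφ0, hφ0'])
    (exists_lagrangian_bound h.abs_u_le hFb (by fun_prop) (by fun_prop) hφc (by fun_prop))
    (exists_lagrangian_bound h.abs_u_le hFb (by fun_prop) (by fun_prop) hφc' (by fun_prop))
    hlow hVx (fun x t => ((hsum t).add ((hφ.hasDerivAt t).const_mul (deriv u₀ x))).add
      ((ha₃' t).const_mul (ρ₀ x)))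
  refine ⟨ρ, u, hsol, fun hu2 => hcl ?_⟩
  have hu' : ContDiff ℝ 1 (deriv u₀) := ((contDiff_succ_iff_deriv (n := 1)).1
    (by simpa [one_add_one_eq_two] using hu2)).2.2
  have hρ' := h.contDiff_ρ
  simp only [hw, ha₁, ha₃]
  fun_prop

end InitialData

/-! ### Breakdown -/

/-- By the divergence theorem on `[a, b] × [0, t]`, classical solutions satisfy the conservation
law in integral form. -/
theorem IsClassicalSolution.isSolution {δ T : ℝ} {ρ₀ u₀ : ℝ → ℝ} {ρ u : ℝ → ℝ → ℝ}
    (h : IsClassicalSolution δ ρ₀ u₀ T ρ u) : IsSolution δ ρ₀ u₀ T ρ u := by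
  refine ⟨h.contDiffOn_ρ.continuousOn, h.contDiffOn_u, h.initial_ρ, h.initial_u, ?_,
    h.momentum_eq, h.farField⟩
  intro a b t ht
  have hsub : uIcc a b ×ˢ uIcc 0 t ⊆ univ ×ˢ Ico 0 T := by
    rw [uIcc_of_le ht.1]
    exact fun p hp => ⟨mem_univ _, hp.2.1, hp.2.2.trans_lt ht.2⟩
  have hflux := h.contDiffOn_ρ.mul h.contDiffOn_u
  set Q := Ioo (min a b) (max a b) ×ˢ Ioo (min 0 t) (max 0 t) with hQ
  have hQ' : ∀ p ∈ Q, p.2 ∈ Ioo 0 T := by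
    rintro p ⟨-, hp⟩
    rw [min_eq_left ht.1, max_eq_right ht.1] at hp
    exact ⟨hp.1, hp.2.trans ht.2⟩
  have hdf : ∀ {f : ℝ × ℝ → ℝ}, ContDiffOn ℝ 1 f (univ ×ˢ Ico 0 T) → ∀ p ∈ Q,
      HasFDerivAt f (Q.indicator (fderiv ℝ f) p) p := by
    intro f hf p hp
    rw [indicator_of_mem hp]
    exact ((hf.contDiffAt (IsSolution.slab_mem_nhds (hQ' p hp))).differentiableAt
      one_ne_zero).hasFDerivAt
  have hdiv : ∀ p : ℝ × ℝ,
      Q.indicator (fderiv ℝ fun p : ℝ × ℝ => ρ p.1 p.2 * u p.1 p.2) p (1, 0)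
        + Q.indicator (fderiv ℝ fun p : ℝ × ℝ => ρ p.1 p.2) p (0, 1) = 0 := by
    intro p
    by_cases hp : p ∈ Q
    · have h1 := hasDerivAt_space_slice (f := fun x t => ρ x t * u x t) (x := p.1) (t := p.2)
        (hdf hflux p hp)
      have h2 := hasDerivAt_time_slice (f := ρ) (x := p.1) (t := p.2) (hdf h.contDiffOn_ρ p hp)
      rw [← h1.deriv, ← h2.deriv, add_comm]
      exact h.continuity_eq p.1 p.2 (hQ' p hp)
    · simp [indicator_of_notMem hp]
  have key := integral2_divergence_prod_of_hasFDerivAt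
    (fun p : ℝ × ℝ => ρ p.1 p.2 * u p.1 p.2) (fun p : ℝ × ℝ => ρ p.1 p.2) _ _ a 0 b t
    (hflux.continuousOn.mono hsub) (h.contDiffOn_ρ.continuousOn.mono hsub)
    (hdf hflux) (hdf h.contDiffOn_ρ) (by simp only [hdiv]; exact integrableOn_zero)
  simp only [hdiv, intervalIntegral.integral_zero, h.initial_ρ] at key
  have hint : ∀ x, IntervalIntegrable (fun s => ρ x s * u x s) volume 0 t := fun x => by
    refine ContinuousOn.intervalIntegrable ?_
    rw [uIcc_of_le ht.1]
    exact (continuousOn_time_slice (f := fun x s => ρ x s * u x s) hflux.continuousOn x).mono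
      fun s hs => ⟨hs.1, hs.2.trans_lt ht.2⟩
  rw [intervalIntegral.integral_sub (hint a) (hint b)]
  linarith

/-- Breakdown means that the Jacobian vanishes somewhere: the maximal life span is the infimum of
the times at which it does. -/
theorem InitialData.finiteTimeBreakdown_iff {δ Cρ Cu : ℝ} {ρ₀ u₀ : ℝ → ℝ}
    (h : InitialData δ ρ₀ u₀ Cρ Cu) {Sol : ℝ → (ℝ → ℝ → ℝ) → (ℝ → ℝ → ℝ) → Prop}
    (hSol : ∀ T ρ u, Sol T ρ u → IsSolution δ ρ₀ u₀ T ρ u)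
    (hex : ∀ T ρ u, IsSolution δ ρ₀ u₀ T ρ u →
      (ContDiff ℝ 2 u₀ → IsClassicalSolution δ ρ₀ u₀ T ρ u) → Sol T ρ u) :
    FiniteTimeBreakdown Sol ↔ ∃ x, BreakdownIneq (∫ y, ρ₀ y) (ρ₀ x) (deriv u₀ x) := by
  obtain ⟨φ, φ', hφ, hφ0, hφ0'⟩ := exists_isDampedOscillator (∫ x, ρ₀ x)
  have hcrit : ∀ x, BreakdownIneq (∫ y, ρ₀ y) (ρ₀ x) (deriv u₀ x) ↔
      ∃ t > 0, stretch (∫ y, ρ₀ y) φ φ' (ρ₀ x) (deriv u₀ x) t ≤ 0 := fun x =>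
    (hφ.exists_stretch_nonpos_iff hφ0 hφ0' h.mass_pos (h.pos x)).symm
  simp_rw [hcrit]
  have hex' : ∀ T, 0 < T → (∀ x, ∀ t ∈ Ico 0 T,
      0 < stretch (∫ x, ρ₀ x) φ φ' (ρ₀ x) (deriv u₀ x) t) → ∃ ρ u, Sol T ρ u := by
    intro T hT hpos
    obtain ⟨ρ, u, h1, h2⟩ := h.exists_isSolution hφ hφ0 hφ0' hT hpos
    exact ⟨ρ, u, hex T ρ u h1 h2⟩
  obtain ⟨ε, hε, hhalf⟩ := h.exists_half_le_stretch hφ hφ0 hφ0'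
  have hstart : ∀ x, 0 < stretch (∫ x, ρ₀ x) φ φ' (ρ₀ x) (deriv u₀ x) 0 := fun x =>
    lt_of_lt_of_le (by norm_num) (hhalf 0 (by simpa using hε) x)
  constructor
  · rintro ⟨T, hT, -, hno⟩
    by_contra! hall
    refine hno (T + 1) (by linarith) (hex' _ (by linarith) fun x t ht => ?_)
    rcases ht.1.eq_or_lt with h0 | h0
    · rw [← h0]
      exact hstart x
    · exact hall x t h0
  · rintro ⟨x₁, t₁, ht₁, hle₁⟩
    set Z := {t | 0 < t ∧ ∃ x, stretch (∫ x, ρ₀ x) φ φ' (ρ₀ x) (deriv u₀ x) t ≤ 0} with hZ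
    have hZε : ∀ t ∈ Z, ε ≤ t := by
      rintro t ⟨ht, x, hx⟩
      by_contra! hlt
      have := hhalf t (by rwa [abs_of_pos ht]) x
      linarith
    have hZne : Z.Nonempty := ⟨t₁, ht₁, x₁, hle₁⟩
    have hT : 0 < sInf Z := hε.trans_le (le_csInf hZne hZε)
    refine ⟨sInf Z, hT, hex' _ hT fun x t ht => ?_, ?_⟩
    · rcases ht.1.eq_or_lt with h0 | h0
      · rw [← h0]
        exact hstart x
      · by_contra! hle
        exact absurd (csInf_le ⟨ε, hZε⟩ (⟨h0, x, hle⟩ : t ∈ Z)) (not_le.2 ht.2)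
    · rintro T' hT' ⟨ρ, u, hρu⟩
      obtain ⟨t, ⟨ht0, x, hx⟩, htT⟩ := exists_lt_of_csInf_lt hZne hT'
      have := (hSol T' ρ u hρu).stretch_pos h hφ hφ0 hφ0' ⟨ht0.le, htT⟩ x
      linarith

theorem initialData_of_japanese_bracket {δ C Cu : ℝ} {ρ₀ u₀ : ℝ → ℝ} (hδ : 0 < δ)
    (hpos : ∀ x, 0 < ρ₀ x) (hρ₀ : ContDiff ℝ 1 ρ₀) (hu₀ : ContDiff ℝ 1 u₀)
    (hCu : ∀ x, |deriv u₀ x| ≤ Cu) (hC : ∀ x, √(1 + x ^ 2) ^ (2 + δ) * ρ₀ x ≤ C) :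
    InitialData δ ρ₀ u₀ (2 ^ (2 + δ) * C) Cu := by
  refine ⟨hδ, hpos, hρ₀, hu₀, hCu, fun x => abs_le_of_decay hδ ?_ fun _ => ?_⟩ <;>
    rw [abs_of_pos (hpos x)] <;> refine le_trans ?_ (hC x)
  · gcongr
    · exact (hpos x).le
    · exact Real.abs_le_sqrt (by linarith)
  · exact le_mul_of_one_le_left (hpos x).le
      (Real.one_le_rpow (Real.one_le_sqrt.2 (by nlinarith)) (by linarith))

end Aggregation

end

theorem theorem5p2 (δ : ℝ) (hδ : 0 < δ) (ρ₀ u₀ : ℝ → ℝ)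
    (hρ₀_pos : ∀ x, 0 < ρ₀ x) (hρ₀ : ContDiff ℝ 1 ρ₀) (hu₀ : ContDiff ℝ 1 u₀)
    (hu₀_bdd : ∃ C : ℝ, ∀ x, |deriv u₀ x| ≤ C)
    (hρ₀_decay : ∃ C : ℝ, ∀ x, √(1 + x ^ 2) ^ (2 + δ) * ρ₀ x ≤ C) :
    (Aggregation.FiniteTimeBreakdown (Aggregation.IsSolution δ ρ₀ u₀) ↔
      ∃ x : ℝ, Aggregation.BreakdownIneq (∫ y, ρ₀ y) (ρ₀ x) (deriv u₀ x)) ∧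
    (ContDiff ℝ 2 u₀ →
      (Aggregation.FiniteTimeBreakdown (Aggregation.IsClassicalSolution δ ρ₀ u₀) ↔
        ∃ x : ℝ, Aggregation.BreakdownIneq (∫ y, ρ₀ y) (ρ₀ x) (deriv u₀ x))) := by
  obtain ⟨Cu, hCu⟩ := hu₀_bdd
  obtain ⟨C, hC⟩ := hρ₀_decay
  have h := Aggregation.initialData_of_japanese_bracket hδ hρ₀_pos hρ₀ hu₀ hCu hC
  exact ⟨h.finiteTimeBreakdown_iff (fun _ _ _ hs => hs) (fun _ _ _ hs _ => hs),
    fun hu2 => h.finiteTimeBreakdown_iff (fun _ _ _ hs => hs.isSolution)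
      (fun _ _ _ _ hs => hs hu2)⟩
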